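/- Let $K$ be a number field with $r$ real places and $s$ conjugate pairs of complex places, let $\mathcal{O}_K$ be its maximal order and $h_K$ its class number. Let $\mathcal{O}$ be an order of $K$ (a subring that is a finitely generated $\mathbb{Z}$-module of rank $[K:\mathbb{Q}]$), let $\mathfrak{m}$ be a nonzero (not necessarily invertible) ideal of $\mathcal{O}$, and let $\Sigma$ be a (possibly empty) set of real embeddings of $K$. Two integral ideals of $\mathcal{O}$ are coprime if their sum is $\mathcal{O}$. A fractional ideal of $\mathcal{O}$ is coprime to $\mathfrak{m}$ if it equals $(\mathfrak{a}:\mathfrak{b})=\{x\in K : x\mathfrak{b}\subseteq\mathfrak{a}\}$ for integral ideals $\mathfrak{a},\mathfrak{b}$ of $\mathcal{O}$ coprime to $\mathfrak{m}$ with $\mathfrak{b}$ invertible. For $\alpha,\beta\in K$ write $\alpha\equiv\beta \pmod{\mathfrak{m}}$ if $\alpha=\alpha_1/\alpha_2$ and $\beta=\beta_1/\beta_2$ for some $\alpha_i,\beta_i\in\mathcal{O}$ with $\alpha_2,\beta_2\neq 0$, $\alpha_2\mathcal{O}$ and $\beta_2\mathcal{O}$ coprime to $\mathfrak{m}$, and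 $\alpha_1\beta_2-\alpha_2\beta_1\in\mathfrak{m}$. The ray class group is $$\mathrm{Cl}_{\mathfrak{m},\Sigma}(\mathcal{O})=\frac{\{\text{invertible fractional ideals of }\mathcal{O}\text{ coprime to }\mathfrak{m}\}}{\{\alpha\mathcal{O} : \alpha\in K^\times,\ \alpha\equiv 1 \ (\mathrm{mod}\ \mathfrak{m}),\ \rho(\alpha)>0 \text{ for all }\rho\in\Sigma\}}.$$ Let $\mathrm{U}_{\mathfrak{m},\Sigma}(\mathcal{O})=\{u\in\mathcal{O}^\times : u-1\in\mathfrak{m},\ \rho(u)>0\text{ for all }\rho\in\Sigma\}$, a subgroup of $\mathcal{O}_K^\times$. Let $\mathfrak{d}=(\mathfrak{m}:\mathcal{O}_K)=\{x\in K : x\mathcal{O}_K\subseteq\mathfrak{m}\}$, which is an ideal of both $\mathcal{O}$ and $\mathcal{O}_K$, and let $\mathrm{U}_{\mathfrak{m}}(\mathcal{O}/\mathfrak{d})$ be the group of units of $\mathcal{O}/\mathfrak{d}$ that are congruent to $1$ modulo the image of $\mathfrak{m}$ in $\mathcal{O}/\mathfrak{d}$. Then the groups $\mathcal{O}_K^\times/\mathrm{U}_{\mathfrak{m},\Sigma}(\mathcal{O})$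 and $\mathrm{Cl}_{\mathfrak{m},\Sigma}(\mathcal{O})$ are finite, and $$\#\mathrm{Cl}_{\mathfrak{m},\Sigma}(\mathcal{O})=\frac{h_K}{[\mathcal{O}_K^\times:\mathrm{U}_{\mathfrak{m},\Sigma}(\mathcal{O})]}\cdot\frac{2^{|\Sigma|}\,\#(\mathcal{O}_K/\mathfrak{d})^\times}{\#\mathrm{U}_{\mathfrak{m}}(\mathcal{O}/\mathfrak{d})}.$$ Moreover, $\operatorname{rank}\mathrm{U}_{\mathfrak{m},\Sigma}(\mathcal{O})=\operatorname{rank}\mathcal{O}_K^\times=r+s-1$. -/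

import Mathlib

open scoped nonZeroDivisors NumberField

/-- An order of the number field `K`: a subring of `K` (containing `1`) that is finitely generated
as a `ℤ`-module, of rank `[K : ℚ]`. -/
class IsNumberFieldOrder {K : Type*} [Field K] [NumberField K] (O : Subring K) : Prop where
  finite : Module.Finite ℤ O
  finrank_eq : Module.finrank ℤ O = Module.finrank ℚ K

namespace IsNumberFieldOrder

variable {K : Type*} [Field K] [NumberField K] (O : Subring K)

/-- The fraction field of an order of `K` is `K`. -/
instance isFractionRing [hO : IsNumberFieldOrder O] : IsFractionRing O K := by
  have hfin := hO.finite
  have hrank := hO.finrank_eq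
  have hdiv : ∀ x : K, ∃ n : ℤ, n ≠ 0 ∧ ∃ y : O, (y : K) = n * x := by
    let b := Module.finBasis ℤ O
    have hli : LinearIndependent ℤ (fun i => ((b i : O) : K)) :=
      b.linearIndependent.map' (O.subtype.toAddMonoidHom.toIntLinearMap)
        (LinearMap.ker_eq_bot.mpr Subtype.val_injective)
    have hliQ : LinearIndependent ℚ (fun i => ((b i : O) : K)) :=
      (LinearIndependent.iff_fractionRing ℤ ℚ).mp hli
    have hspan : Submodule.span ℚ (Set.range fun i => ((b i : O) : K)) = ⊤ :=
      hliQ.span_eq_top_of_card_eq_finrank' (by simpa using hrank)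
    intro x
    have hx : x ∈ Submodule.span ℚ (Set.range fun i => ((b i : O) : K)) := hspan ▸ trivial
    induction hx using Submodule.span_induction with
    | mem x hx =>
      obtain ⟨i, rfl⟩ := hx
      exact ⟨1, one_ne_zero, b i, by simp⟩
    | zero => exact ⟨1, one_ne_zero, 0, by simp⟩
    | add x y _ _ hx hy =>
      obtain ⟨n, hn, u, hu⟩ := hx
      obtain ⟨m, hm, v, hv⟩ := hy
      exact ⟨n * m, mul_ne_zero hn hm, m * u + n * v, by push_cast [hu, hv]; ring⟩
    | smul q x _ hx =>
      obtain ⟨n, hn, u, hu⟩ := hx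
      refine ⟨q.den * n, mul_ne_zero (by exact_mod_cast q.den_nz) hn, q.num * u, ?_⟩
      have hq : ((q : ℚ) : K) * (q.den : K) = (q.num : K) := by
        exact_mod_cast congrArg (fun t : ℚ => (t : K)) (Rat.mul_den_eq_num q)
      push_cast [hu, ← hq, Rat.smul_def]
      ring
  refine IsFractionRing.of_field O K fun x => ?_
  obtain ⟨n, hn, y, hy⟩ := hdiv x
  refine ⟨y, (n : O), ?_⟩
  have hn' : (n : K) ≠ 0 := by exact_mod_cast hn
  change x = (y : K) / ((n : O) : K)
  rw [hy]
  push_cast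
  field_simp

variable {O} in
theorem isIntegral [hO : IsNumberFieldOrder O] (x : O) : IsIntegral ℤ (x : K) := by
  have := hO.finite
  exact (IsIntegral.of_finite ℤ x).map (O.subtype.toIntAlgHom)

/-- The inclusion of an order into the maximal order. -/
noncomputable def inclusion [IsNumberFieldOrder O] : O →+* 𝓞 K where
  toFun x := ⟨x, isIntegral x⟩
  map_one' := rfl
  map_mul' _ _ := rfl
  map_zero' := rfl
  map_add' _ _ := rfl

@[simp] theorem coe_inclusion [IsNumberFieldOrder O] (x : O) : ((inclusion O x : 𝓞 K) : K) = x := rfl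

end IsNumberFieldOrder

section UnitGroups

/-- `U_I(R)`: the units of the commutative ring `R` that are congruent to `1` modulo `I`. -/
def unitsCongrOne {R : Type*} [CommRing R] (I : Ideal R) : Subgroup Rˣ where
  carrier := {u | (u : R) - 1 ∈ I}
  one_mem' := by simp
  mul_mem' {u v} hu hv := by
    have h : ((u * v : Rˣ) : R) - 1 = u * ((v : R) - 1) + ((u : R) - 1) := by push_cast; ring
    change ((u * v : Rˣ) : R) - 1 ∈ I
    rw [h]
    exact I.add_mem (I.mul_mem_left _ hv) hu
  inv_mem' {u} hu := by
    have h : ((u⁻¹ : Rˣ) : R) - 1 = -((u⁻¹ : Rˣ) : R) * ((u : R) - 1) := by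
      linear_combination (u.inv_mul)
    change ((u⁻¹ : Rˣ) : R) - 1 ∈ I
    rw [h]
    exact I.mul_mem_left _ hu

variable {K : Type*} [Field K]

/-- The elements of `Kˣ` that are positive under every real embedding in `Σ`. -/
def positiveAt (S : Finset (K →+* ℝ)) : Subgroup Kˣ where
  carrier := {x | ∀ ρ ∈ S, 0 < ρ x}
  one_mem' := by simp
  mul_mem' {x y} hx hy ρ hρ := by simpa using mul_pos (hx ρ hρ) (hy ρ hρ)
  inv_mem' {x} hx ρ hρ := by simpa using hx ρ hρ

/-- `U_{𝔪,Σ}(O)`: the units of `O` that are congruent to `1` modulo `𝔪` and positive under every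
real embedding in `Σ`. -/
def rayUnitGroup (O : Subring K) (m : Ideal O) (S : Finset (K →+* ℝ)) : Subgroup Oˣ :=
  unitsCongrOne m ⊓ (positiveAt S).comap (Units.map (O.subtype : O →* K))

theorem mem_rayUnitGroup {O : Subring K} {m : Ideal O} {S : Finset (K →+* ℝ)} {u : Oˣ} :
    u ∈ rayUnitGroup O m S ↔ (u : O) - 1 ∈ m ∧ ∀ ρ ∈ S, 0 < ρ ((u : O) : K) := Iff.rfl

end UnitGroups

section RayClassGroup

variable {K : Type*} [Field K] (O : Subring K) (m : Ideal O)

/-- The congruence `α ≡ β (mod 𝔪)` for elements of `K`: one can write `α = α₁ / α₂` and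
`β = β₁ / β₂` with all `αᵢ, βᵢ` in `O`, the ideals `α₂ O` and `β₂ O` coprime to `𝔪`, and
`α₁ β₂ - α₂ β₁ ∈ 𝔪`. -/
def RayCongr (α β : K) : Prop :=
  ∃ α₁ α₂ β₁ β₂ : O, α₂ ≠ 0 ∧ β₂ ≠ 0 ∧ α = α₁ / α₂ ∧ β = β₁ / β₂ ∧
    Ideal.span {α₂} ⊔ m = ⊤ ∧ Ideal.span {β₂} ⊔ m = ⊤ ∧ α₁ * β₂ - α₂ * β₁ ∈ m

variable {O m}

theorem span_singleton_sup_eq_top_iff {a : O} :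
    Ideal.span {a} ⊔ m = ⊤ ↔ ∃ c : O, c * a - 1 ∈ m := by
  rw [Ideal.eq_top_iff_one, Submodule.mem_sup]
  constructor
  · rintro ⟨y, hy, z, hz, h⟩
    obtain ⟨c, rfl⟩ := Ideal.mem_span_singleton'.mp hy
    refine ⟨c, ?_⟩
    have : c * a - 1 = -z := by rw [← h]; ring
    rw [this]
    exact m.neg_mem hz
  · rintro ⟨c, hc⟩
    exact ⟨c * a, Ideal.mem_span_singleton'.mpr ⟨c, rfl⟩, -(c * a - 1), m.neg_mem hc, by ring⟩

/-- A simpler form of the congruence `α ≡ 1 (mod 𝔪)`. -/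
theorem rayCongr_one_iff {α : K} : RayCongr O m α 1 ↔
    ∃ a b : O, b ≠ 0 ∧ α = a / b ∧ Ideal.span {b} ⊔ m = ⊤ ∧ a - b ∈ m := by
  constructor
  · rintro ⟨a, b, c, d, hb, hd, h1, h2, h3, h4, h5⟩
    refine ⟨a, b, hb, h1, h3, ?_⟩
    have hd' : (d : K) ≠ 0 := by simpa using hd
    have hcd : c = d := by
      rw [eq_div_iff hd', one_mul] at h2
      exact Subtype.ext h2.symm
    obtain ⟨e, he⟩ := span_singleton_sup_eq_top_iff.mp h4
    have : a - b = e * (a * d - b * c) - (a - b) * (e * d - 1) := by rw [hcd]; ring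
    rw [this]
    exact m.sub_mem (m.mul_mem_left _ h5) (m.mul_mem_left _ he)
  · rintro ⟨a, b, hb, h1, h2, h3⟩
    refine ⟨a, b, 1, 1, hb, one_ne_zero, h1, by simp, h2, ?_, by simpa using h3⟩
    simp

variable (O m)

/-- The elements of `Kˣ` that are congruent to `1` modulo `𝔪`. -/
def congrOneSubgroup : Subgroup Kˣ where
  carrier := {α | RayCongr O m (α : K) 1}
  one_mem' := rayCongr_one_iff.mpr ⟨1, 1, one_ne_zero, by simp, by simp, by simp⟩
  mul_mem' {α β} hα hβ := by
    obtain ⟨a, b, hb, h1, h2, h3⟩ := rayCongr_one_iff.mp hα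
    obtain ⟨c, d, hd, k1, k2, k3⟩ := rayCongr_one_iff.mp hβ
    refine rayCongr_one_iff.mpr ⟨a * c, b * d, mul_ne_zero hb hd, ?_, ?_, ?_⟩
    · push_cast
      rw [h1, k1, div_mul_div_comm]
    · obtain ⟨e, he⟩ := span_singleton_sup_eq_top_iff.mp h2
      obtain ⟨f, hf⟩ := span_singleton_sup_eq_top_iff.mp k2
      refine span_singleton_sup_eq_top_iff.mpr ⟨e * f, ?_⟩
      have : e * f * (b * d) - 1 = (f * d) * (e * b - 1) + (f * d - 1) := by ring
      rw [this]
      exact m.add_mem (m.mul_mem_left _ he) hf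
    · have : a * c - b * d = c * (a - b) + b * (c - d) := by ring
      rw [this]
      exact m.add_mem (m.mul_mem_left _ h3) (m.mul_mem_left _ k3)
  inv_mem' {α} hα := by
    obtain ⟨a, b, hb, h1, h2, h3⟩ := rayCongr_one_iff.mp hα
    have ha : a ≠ 0 := by
      rintro rfl
      simp at h1
    refine rayCongr_one_iff.mpr ⟨b, a, ha, ?_, ?_, ?_⟩
    · rw [Units.val_inv_eq_inv_val, h1, inv_div]
    · obtain ⟨e, he⟩ := span_singleton_sup_eq_top_iff.mp h2
      refine span_singleton_sup_eq_top_iff.mpr ⟨e, ?_⟩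
      have : e * a - 1 = e * (a - b) + (e * b - 1) := by ring
      rw [this]
      exact m.add_mem (m.mul_mem_left _ h3) he
    · rw [← neg_sub]
      exact m.neg_mem h3

/-- A fractional ideal of `O` is coprime to `𝔪` if it is an ideal quotient
`(𝔞 : 𝔟) = {x ∈ K | x 𝔟 ⊆ 𝔞}` of integral ideals `𝔞, 𝔟` coprime to `𝔪` with `𝔟` invertible. -/
def FractionalCoprime (I : FractionalIdeal O⁰ K) : Prop :=
  ∃ a b : Ideal O, a ⊔ m = ⊤ ∧ b ⊔ m = ⊤ ∧ IsUnit (b : FractionalIdeal O⁰ K) ∧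
    (I : Submodule O K) =
      ((a : FractionalIdeal O⁰ K) : Submodule O K) / ((b : FractionalIdeal O⁰ K) : Submodule O K)

variable {O m}

/-- If `𝔟` is invertible, then `I = (𝔞 : 𝔟)` says that `I 𝔟 = 𝔞`. -/
theorem coe_eq_div_iff {I a b : FractionalIdeal O⁰ K} (hb : IsUnit b) :
    (I : Submodule O K) = (a : Submodule O K) / (b : Submodule O K) ↔ I * b = a := by
  obtain ⟨b, rfl⟩ := hb
  have key : (a : Submodule O K) / ((b : FractionalIdeal O⁰ K) : Submodule O K) =
      ((a * ((b⁻¹ : (FractionalIdeal O⁰ K)ˣ) : FractionalIdeal O⁰ K) : FractionalIdeal O⁰ K) :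
        Submodule O K) := by
    apply le_antisymm
    · have h2 : ((b : FractionalIdeal O⁰ K) * ((b⁻¹ : (FractionalIdeal O⁰ K)ˣ) :
          FractionalIdeal O⁰ K)) = 1 := b.mul_inv
      calc _ = ((a : Submodule O K) / ((b : FractionalIdeal O⁰ K) : Submodule O K)) *
            (((b : FractionalIdeal O⁰ K) * ((b⁻¹ : (FractionalIdeal O⁰ K)ˣ) :
          FractionalIdeal O⁰ K) : FractionalIdeal O⁰ K) : Submodule O K) := by
              rw [h2, FractionalIdeal.coe_one, mul_one]
        _ ≤ _ := by
              rw [FractionalIdeal.coe_mul, FractionalIdeal.coe_mul, ← mul_assoc]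
              exact mul_le_mul' (Submodule.le_div_iff_mul_le.mp le_rfl) le_rfl
    · rw [Submodule.le_div_iff_mul_le, ← FractionalIdeal.coe_mul, mul_assoc, b.inv_mul, mul_one]
  rw [key, FractionalIdeal.coeToSubmodule_inj, Units.eq_mul_inv_iff_mul_eq]

theorem fractionalCoprime_iff {I : FractionalIdeal O⁰ K} : FractionalCoprime O m I ↔
    ∃ a b : Ideal O, a ⊔ m = ⊤ ∧ b ⊔ m = ⊤ ∧ IsUnit (b : FractionalIdeal O⁰ K) ∧
      I * (b : FractionalIdeal O⁰ K) = (a : FractionalIdeal O⁰ K) := by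
  refine exists_congr fun a => exists_congr fun b => ?_
  refine and_congr_right fun _ => and_congr_right fun _ => and_congr_right fun hb => ?_
  exact coe_eq_div_iff hb

variable (O m)

/-- `J*_𝔪(O)`: the group of invertible fractional ideals of `O` coprime to `𝔪`. -/
def coprimeFractionalIdeals : Subgroup (FractionalIdeal O⁰ K)ˣ where
  carrier := {I | FractionalCoprime O m (I : FractionalIdeal O⁰ K)}
  one_mem' := fractionalCoprime_iff.mpr ⟨⊤, ⊤, by simp, by simp, by simp, by simp⟩
  mul_mem' {I J} hI hJ := by
    obtain ⟨a, b, ha, hb, hu, h⟩ := fractionalCoprime_iff.mp hI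
    obtain ⟨c, d, hc, hd, hv, k⟩ := fractionalCoprime_iff.mp hJ
    refine fractionalCoprime_iff.mpr ⟨a * c, b * d, ?_, ?_, ?_, ?_⟩
    · exact (Ideal.isCoprime_iff_sup_eq.mp
        ((Ideal.isCoprime_iff_sup_eq.mpr ha).mul_left (Ideal.isCoprime_iff_sup_eq.mpr hc)))
    · exact (Ideal.isCoprime_iff_sup_eq.mp
        ((Ideal.isCoprime_iff_sup_eq.mpr hb).mul_left (Ideal.isCoprime_iff_sup_eq.mpr hd)))
    · rw [FractionalIdeal.coeIdeal_mul]
      exact hu.mul hv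
    · rw [FractionalIdeal.coeIdeal_mul, FractionalIdeal.coeIdeal_mul, ← h, ← k, Units.val_mul]
      exact mul_mul_mul_comm _ _ _ _
  inv_mem' {I} hI := by
    obtain ⟨a, b, ha, hb, hu, h⟩ := fractionalCoprime_iff.mp hI
    refine fractionalCoprime_iff.mpr ⟨b, a, hb, ha, ?_, ?_⟩
    · rw [← h]
      exact I.isUnit.mul hu
    · rw [← h, Units.inv_mul_cancel_left]

variable (S : Finset (K →+* ℝ))

/-- `P_{𝔪,Σ}(O)`: the group of principal fractional ideals `α O` with `α ∈ Kˣ`,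
`α ≡ 1 (mod 𝔪)` and `ρ(α) > 0` for all `ρ ∈ Σ`. -/
noncomputable def principalRayIdeals [IsFractionRing O K] : Subgroup (FractionalIdeal O⁰ K)ˣ :=
  (congrOneSubgroup O m ⊓ positiveAt S).map (toPrincipalIdeal O K)

/-- `P_{𝔪,Σ}(O)` is contained in `J*_𝔪(O)`. -/
theorem principalRayIdeals_le [IsFractionRing O K] :
    principalRayIdeals O m S ≤ coprimeFractionalIdeals O m := by
  rintro _ ⟨α, ⟨hα, -⟩, rfl⟩
  obtain ⟨a, b, hb, h1, h2, h3⟩ := rayCongr_one_iff.mp hα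
  have hb' : (b : K) ≠ 0 := by simpa using hb
  refine fractionalCoprime_iff.mpr ⟨Ideal.span {a}, Ideal.span {b}, ?_, h2, ?_, ?_⟩
  · obtain ⟨e, he⟩ := span_singleton_sup_eq_top_iff.mp h2
    refine span_singleton_sup_eq_top_iff.mpr ⟨e, ?_⟩
    have : e * a - 1 = e * (a - b) + (e * b - 1) := by ring
    rw [this]
    exact m.add_mem (m.mul_mem_left _ h3) he
  · rw [FractionalIdeal.coeIdeal_span_singleton]
    exact ⟨toPrincipalIdeal O K (Units.mk0 (b : K) hb'),
      coe_toPrincipalIdeal (R := O) (K := K) (Units.mk0 (b : K) hb')⟩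
  · rw [FractionalIdeal.coeIdeal_span_singleton, FractionalIdeal.coeIdeal_span_singleton,
      coe_toPrincipalIdeal, FractionalIdeal.spanSingleton_mul_spanSingleton, h1]
    congr 1
    exact div_mul_cancel₀ _ hb'

/-- The ray class group `Cl_{𝔪,Σ}(O) = J*_𝔪(O) / P_{𝔪,Σ}(O)`. -/
abbrev RayClassGroup [IsFractionRing O K] : Type _ :=
  coprimeFractionalIdeals O m ⧸
    (principalRayIdeals O m S).subgroupOf (coprimeFractionalIdeals O m)

end RayClassGroup

section Colon

variable {K : Type*} [Field K] (O : Subring K) (m : Ideal O)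

/-- The quotient ideal `(𝔪 : 𝓞_K) = {x ∈ K | x 𝓞_K ⊆ 𝔪}`, as an `𝓞_K`-submodule of `K`. -/
def colonMaximalOrder : Submodule (𝓞 K) K where
  carrier := {x | ∀ y : 𝓞 K, ∃ z ∈ m, (z : K) = x * (y : K)}
  add_mem' {x x'} hx hx' y := by
    obtain ⟨z, hz, h⟩ := hx y
    obtain ⟨z', hz', h'⟩ := hx' y
    exact ⟨z + z', m.add_mem hz hz', by push_cast [h, h']; ring⟩
  zero_mem' y := ⟨0, m.zero_mem, by simp⟩
  smul_mem' c x hx y := by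
    obtain ⟨z, hz, h⟩ := hx (c * y)
    refine ⟨z, hz, ?_⟩
    rw [h, Algebra.smul_def]
    change x * ((c : K) * (y : K)) = (c : K) * x * (y : K)
    ring

/-- `(𝔪 : 𝓞_K)` is contained in `𝔪`, hence in `O` and in `𝓞_K`. -/
theorem exists_mem_of_mem_colonMaximalOrder {x : K} (hx : x ∈ colonMaximalOrder O m) :
    ∃ z ∈ m, (z : K) = x := by
  simpa using hx 1

/-- `(𝔪 : 𝓞_K)` as an ideal of `𝓞_K`. -/
def colonIdealMax : Ideal (𝓞 K) :=
  (colonMaximalOrder O m).comap (Algebra.linearMap (𝓞 K) K)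

/-- `(𝔪 : 𝓞_K)` as an ideal of `O`. -/
def colonIdealOrder : Ideal O where
  carrier := {x | (x : K) ∈ colonMaximalOrder O m}
  add_mem' hx hy := by simpa using (colonMaximalOrder O m).add_mem hx hy
  zero_mem' := by simp
  smul_mem' c x hx y := by
    obtain ⟨z, hz, h⟩ := hx y
    exact ⟨c * z, m.mul_mem_left c hz, by push_cast [h, smul_eq_mul]; ring⟩

end Colon

/-! Put d = (m : 𝓞_K), an ideal of both rings. Away from d the two rings have the same ideals:
contraction and extension are mutually inverse on integral ideals coprime to d. Let H be the group
of invertible fractional ideals of O coprime to d, and P the group of principal ray ideals. Every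
ray class meets H (`coprimeFractionalIdeals_sup_principalRayIdeals`), so the ray class group is H/(P
∩ H). Extension to 𝓞_K is injective on H (`eq_one_of_extendUnits_eq_one`), and H reaches every ideal
class of 𝓞_K (`range_toPrincipalIdeal_sup_map`), so the ideals of H with principal extension form a
subgroup N of index h_K.

Now pass to generators. Let T be the group of α with α𝓞_K extended from H, and T' its subgroup of
ray elements α with αO in H. Then α ↦ α𝓞_K gives N ≅ T/𝓞_K^×, under which P ∩ H is the image of T'.
Since T' ∩ 𝓞_K^× is the ray unit group U, this yields #Cl · [𝓞_K^× : U] = h_K · [T : T']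
(`relIndex_principalRayIdeals`).

Residues modulo d together with signs at S map T onto (𝓞_K/d)^× × {±1}^S, and T' is the preimage of
U_m(O/d) × 1. This computes [T : T'] (`relIndex_coprimeRayElements`), and the formula follows. An
infinite index counts as 0, so the product identity, whose right side is nonzero, also proves
finiteness. Finite index of U and Dirichlet's unit theorem give the ranks. -/

section Avoidance

/-! ### Prime avoidance and cofactors of invertible ideals. -/

variable {R : Type*} [CommRing R]

/-- An element can be moved by elements of `N` out of finitely many submodules `p • M`, with `p`
maximal, that do not contain `N`. -/
theorem exists_add_notMem_smul {M : Type*} [AddCommGroup M] [Module R M] (N : Submodule R M)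
    (P : Finset (Ideal R)) (hP : ∀ p ∈ P, p.IsMaximal)
    (hN : ∀ p ∈ P, ¬ N ≤ p • (⊤ : Submodule R M)) (e : M) :
    ∃ y ∈ N, ∀ p ∈ P, e + y ∉ p • (⊤ : Submodule R M) := by
  classical
  induction P using Finset.induction_on with
  | empty => exact ⟨0, N.zero_mem, by simp⟩
  | insert q P hq ih =>
    obtain ⟨y, hy, h⟩ := ih (fun p hp => hP p (Finset.mem_insert_of_mem hp))
      (fun p hp => hN p (Finset.mem_insert_of_mem hp))
    by_cases hqy : e + y ∈ q • (⊤ : Submodule R M)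
    · have hqmax := hP q (Finset.mem_insert_self q P)
      obtain ⟨z, hzN, hz⟩ := SetLike.not_le_iff_exists.mp (hN q (Finset.mem_insert_self q P))
      -- Choose t in every p of P but not in q: adding t • z repairs q and changes nothing modulo
      -- the other p • M.
      have hprod : ¬ (P.inf id : Ideal R) ≤ q := by
        rw [hqmax.isPrime.inf_le']
        rintro ⟨p, hp, hpq⟩
        have := (hP p (Finset.mem_insert_of_mem hp)).eq_of_le hqmax.ne_top hpq
        exact hq (this ▸ hp)
      obtain ⟨t, ht, htq⟩ := SetLike.not_le_iff_exists.mp hprod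
      refine ⟨y + t • z, N.add_mem hy (N.smul_mem _ hzN), fun p hp => ?_⟩
      rw [← add_assoc]
      rcases Finset.mem_insert.mp hp with rfl | hp'
      · intro hmem
        have htz : t • z ∈ p • (⊤ : Submodule R M) := by
          simpa using Submodule.sub_mem _ hmem hqy
        obtain ⟨s, i, hi, hs⟩ := hqmax.exists_inv htq
        apply hz
        have : z = s • t • z + i • z := by rw [smul_smul, ← add_smul, hs, one_smul]
        rw [this]
        exact Submodule.add_mem _ (Submodule.smul_mem _ _ htz)
          (Submodule.smul_mem_smul hi Submodule.mem_top)
      · intro hmem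
        have htp : t ∈ p := (Finset.inf_le hp' : P.inf id ≤ p) ht
        apply h p hp'
        simpa using Submodule.sub_mem _ hmem
          (Submodule.smul_mem_smul htp (Submodule.mem_top : z ∈ (⊤ : Submodule R M)))
    · refine ⟨y, hy, fun p hp => ?_⟩
      rcases Finset.mem_insert.mp hp with rfl | hp'
      exacts [hqy, h p hp']

/-- The version of `exists_add_notMem_smul` for products of ideals. -/
theorem exists_add_notMem_mul {a N : Ideal R} (hNa : N ≤ a)
    (P : Finset (Ideal R)) (hP : ∀ p ∈ P, p.IsMaximal)
    (hN : ∀ p ∈ P, ¬ N ≤ p * a) {e : R} (he : e ∈ a) :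
    ∃ y ∈ N, ∀ p ∈ P, e + y ∉ p * a := by
  have key : ∀ (p : Ideal R) (z : a), z ∈ p • (⊤ : Submodule R a) ↔ (z : R) ∈ p * a := by
    intro p z
    have h : Submodule.map a.subtype (p • (⊤ : Submodule R a)) = p * a := by
      rw [Submodule.map_smul'', Submodule.map_subtype_top, smul_eq_mul]
    rw [← h]
    refine ⟨fun hz => Submodule.mem_map_of_mem hz, ?_⟩
    rintro ⟨w, hw, hwz⟩
    rwa [← Subtype.ext hwz]
  obtain ⟨y, hy, h⟩ := exists_add_notMem_smul (Submodule.comap (Submodule.subtype a) N) P hP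
    (fun p hp hle => hN p hp fun z hz =>
      (key p ⟨z, hNa hz⟩).mp (hle (Submodule.mem_comap.mpr hz))) ⟨e, he⟩
  exact ⟨y, hy, fun p hp hmem => h p hp ((key p _).mpr hmem)⟩

theorem finite_maximal_ge (d : Ideal R) [Finite (R ⧸ d)] :
    {p : Ideal R | p.IsMaximal ∧ d ≤ p}.Finite := by
  have hfin : Finite (Ideal (R ⧸ d)) := by
    have : Function.Injective (fun I : Ideal (R ⧸ d) => (I : Set (R ⧸ d))) := SetLike.coe_injective
    exact Finite.of_injective _ this
  refine Set.Finite.subset (Set.finite_range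
    fun I : Ideal (R ⧸ d) => I.comap (Ideal.Quotient.mk d)) fun p hp => ?_
  refine ⟨p.map (Ideal.Quotient.mk d), ?_⟩
  simp only
  rw [Ideal.comap_map_of_surjective' _ Ideal.Quotient.mk_surjective, Ideal.mk_ker]
  exact sup_eq_left.mpr hp.2

variable [IsDomain R]

theorem span_singleton_mul_le_cancel {n : R} (hn : n ≠ 0) {I J : Ideal R}
    (h : Ideal.span {n} * I ≤ Ideal.span {n} * J) : I ≤ J :=
  (Ideal.span_singleton_mul_right_mono hn).mp h

/-- Cancellation of an ideal that divides a nonzero principal ideal. -/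
theorem le_of_mul_le_mul_of_mul_eq_span {a a' I J : Ideal R} {n : R} (hn : n ≠ 0)
    (ha : a * a' = Ideal.span {n}) (h : I * a ≤ J * a) : I ≤ J := by
  apply span_singleton_mul_le_cancel hn
  rw [← ha, mul_comm _ I, mul_comm _ J, ← mul_assoc, ← mul_assoc]
  exact Ideal.mul_mono_left h

/-- If `a` divides a nonzero principal ideal, then it divides the ideals generated by its
elements. -/
theorem exists_mul_eq_span_of_mem {a a' : Ideal R} {n x : R} (hn : n ≠ 0)
    (ha : a * a' = Ideal.span {n}) (hxa : x ∈ a) : ∃ c : Ideal R, c * a = Ideal.span {x} := by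
  have hle : Ideal.span {x} * a' ≤ Ideal.span {n} := by
    rw [← ha]
    exact Ideal.mul_mono_left ((Ideal.span_singleton_le_iff_mem _).mpr hxa)
  -- Since a' = n a⁻¹, the cofactor x a⁻¹ is x a' divided by n.
  have hc : Ideal.span {n} * Submodule.comap (LinearMap.mulLeft R n) (Ideal.span {x} * a') =
      Ideal.span {x} * a' := by
    refine le_antisymm (Ideal.span_singleton_mul_le_iff.mpr fun z hz => hz) fun z hz => ?_
    obtain ⟨w, rfl⟩ := Ideal.mem_span_singleton.mp (hle hz)
    exact Ideal.mem_span_singleton_mul.mpr ⟨w, hz, rfl⟩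
  refine ⟨Submodule.comap (LinearMap.mulLeft R n) (Ideal.span {x} * a'), ?_⟩
  have h1 : Ideal.span {n} * (Submodule.comap (LinearMap.mulLeft R n) (Ideal.span {x} * a') * a) =
      Ideal.span {n} * Ideal.span {x} := by
    rw [← mul_assoc, hc, mul_assoc, mul_comm a' a, ha, mul_comm]
  exact le_antisymm (span_singleton_mul_le_cancel hn h1.le)
    (span_singleton_mul_le_cancel hn h1.ge)

/-- In an invertible ideal `a` coprime to `m`, there is an element `x ≡ 1 (mod m)`
that generates `a` modulo `a d`. -/
theorem exists_mem_sup_mul_eq {a a' m d : Ideal R} {n : R} (hn : n ≠ 0)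
    (ha : a * a' = Ideal.span {n}) (ham : a ⊔ m = ⊤) [Finite (R ⧸ d)] :
    ∃ x ∈ a, x - 1 ∈ m ∧ Ideal.span {x} ⊔ a * d = a := by
  classical
  obtain ⟨e, he, f, hf, hef⟩ := Submodule.mem_sup.mp ((Ideal.eq_top_iff_one _).mp ham)
  have hfin : {p : Ideal R | (p.IsMaximal ∧ d ≤ p) ∧ ¬ m ≤ p}.Finite :=
    (finite_maximal_ge d).subset fun p hp => hp.1
  -- Corrections from m a preserve the congruence e ≡ 1 (mod m). Only primes not containing m need
  -- avoiding: at those containing m, the congruence already keeps the element out of p.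
  obtain ⟨y, hy, h⟩ := exists_add_notMem_mul (a := a) (N := m * a) Ideal.mul_le_right hfin.toFinset
    (fun p hp => ((hfin.mem_toFinset.mp hp).1).1)
    (fun p hp hle => (hfin.mem_toFinset.mp hp).2 (le_of_mul_le_mul_of_mul_eq_span hn ha hle)) he
  have hxa : e + y ∈ a := a.add_mem he (Ideal.mul_le_right hy)
  have hxm : e + y - 1 ∈ m := by
    rw [← hef, show e + y - (e + f) = y - f by ring]
    exact m.sub_mem (Ideal.mul_le_left hy) hf
  refine ⟨e + y, hxa, hxm, ?_⟩
  obtain ⟨c, hca⟩ := exists_mul_eq_span_of_mem hn ha hxa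
  -- A maximal p containing c and d would put the element into p a, which was excluded.
  have htop : c ⊔ d = ⊤ := by
    by_contra hne
    obtain ⟨p, hp, hle⟩ := Ideal.exists_le_maximal _ hne
    have hmem : e + y ∈ p * a := by
      have : Ideal.span {e + y} ≤ p * a := by
        rw [← hca]
        exact Ideal.mul_mono_left (le_sup_left.trans hle)
      exact this (Ideal.mem_span_singleton_self _)
    by_cases hmp : m ≤ p
    · apply hp.ne_top
      rw [Ideal.eq_top_iff_one]
      have := p.sub_mem (Ideal.mul_le_left hmem) (hmp hxm)
      simpa using this
    · exact h p (hfin.mem_toFinset.mpr ⟨⟨hp, le_sup_right.trans hle⟩, hmp⟩) hmem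
  rw [← hca, mul_comm a d, ← Ideal.sup_mul, htop, Ideal.top_mul]

/-- An ideal `a` dividing a nonzero principal ideal contains a cofactor of `x`, coprime to `d`, if
`x` generates `a` modulo `a d`. -/
theorem exists_mul_eq_span_of_sup_mul_eq {a a' d : Ideal R} {n x : R} (hn : n ≠ 0)
    (ha : a * a' = Ideal.span {n}) (hx : Ideal.span {x} ⊔ a * d = a) :
    ∃ c : Ideal R, c * a = Ideal.span {x} ∧ c ⊔ d = ⊤ := by
  have hxa : x ∈ a := by
    rw [← hx]
    exact Ideal.mem_sup_left (Ideal.mem_span_singleton_self x)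
  obtain ⟨c, hca⟩ := exists_mul_eq_span_of_mem hn ha hxa
  refine ⟨c, hca, top_unique (le_of_mul_le_mul_of_mul_eq_span hn ha ?_)⟩
  rw [Ideal.top_mul, Ideal.sup_mul, hca, mul_comm d a, hx]

end Avoidance

/-! ### Two rings sharing an ideal: the correspondence away from it. -/

section SharedIdeal

variable {A B : Type*} [CommRing A] [CommRing B] {f : A →+* B} {d : Ideal A} {D : Ideal B}

/-- If the ideal `D` of `B` is the image of an ideal `d` of `A`, then ideals of `A` coprime to `d`
are contracted from `B`. -/
theorem comap_map_eq_of_sup_eq_top (hf : Function.Injective f)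
    (hD : ∀ b, b ∈ D ↔ ∃ a ∈ d, f a = b) {a : Ideal A} (ha : a ⊔ d = ⊤) :
    (a.map f).comap f = a := by
  refine le_antisymm (fun x hx => ?_) Ideal.le_comap_map
  -- Multiplication by d brings the extension of a back into a, because d is stable under B. Applied
  -- to 1 = u + e with u in a and e in d, it gives x = x u + x e in a.
  have key : ∀ z ∈ a.map f, ∀ e ∈ d, ∃ w ∈ a, f w = z * f e := by
    intro z hz
    induction hz using Submodule.span_induction with
    | mem z hz =>
      obtain ⟨w, hw, rfl⟩ := hz
      exact fun e _ => ⟨w * e, a.mul_mem_right _ hw, by simp⟩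
    | zero => exact fun e _ => ⟨0, a.zero_mem, by simp⟩
    | add y z _ _ hy hz =>
      intro e he
      obtain ⟨v, hv, hv'⟩ := hy e he
      obtain ⟨w, hw, hw'⟩ := hz e he
      exact ⟨v + w, a.add_mem hv hw, by rw [map_add, hv', hw', add_mul]⟩
    | smul b z _ hz =>
      intro e he
      obtain ⟨e', he', h⟩ := (hD (b * f e)).mp (D.mul_mem_left _ ((hD _).mpr ⟨e, he, rfl⟩))
      obtain ⟨w, hw, hw'⟩ := hz e' he'
      exact ⟨w, hw, by rw [hw', h, smul_eq_mul]; ring⟩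
  obtain ⟨u, hu, e, he, hue⟩ := Submodule.mem_sup.mp ((Ideal.eq_top_iff_one _).mp ha)
  obtain ⟨w, hw, hw'⟩ := key (f x) hx e he
  rw [← map_mul] at hw'
  rw [← mul_one x, ← hue, mul_add, ← hf hw']
  exact a.add_mem (a.mul_mem_left _ hu) hw

theorem eq_of_map_eq_map_of_sup_eq_top (hf : Function.Injective f)
    (hD : ∀ b, b ∈ D ↔ ∃ a ∈ d, f a = b) {a b : Ideal A} (ha : a ⊔ d = ⊤) (hb : b ⊔ d = ⊤)
    (h : a.map f = b.map f) : a = b := by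
  rw [← comap_map_eq_of_sup_eq_top hf hD ha, h, comap_map_eq_of_sup_eq_top hf hD hb]

theorem map_sup_eq_top_of_sup_eq_top (hD : ∀ b, b ∈ D ↔ ∃ a ∈ d, f a = b) {a : Ideal A}
    (ha : a ⊔ d = ⊤) : a.map f ⊔ D = ⊤ := by
  obtain ⟨u, hu, e, he, hue⟩ := Submodule.mem_sup.mp ((Ideal.eq_top_iff_one _).mp ha)
  refine (Ideal.eq_top_iff_one _).mpr (Submodule.mem_sup.mpr
    ⟨f u, Ideal.mem_map_of_mem f hu, f e, (hD _).mpr ⟨e, he, rfl⟩, ?_⟩)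
  rw [← map_add, hue, map_one]

theorem comap_sup_eq_top_of_sup_eq_top (hD : ∀ b, b ∈ D ↔ ∃ a ∈ d, f a = b) {C : Ideal B}
    (hC : C ⊔ D = ⊤) : C.comap f ⊔ d = ⊤ := by
  obtain ⟨u, hu, e, he, hue⟩ := Submodule.mem_sup.mp ((Ideal.eq_top_iff_one _).mp hC)
  obtain ⟨e', he', rfl⟩ := (hD e).mp he
  refine (Ideal.eq_top_iff_one _).mpr (Submodule.mem_sup.mpr ⟨1 - e', ?_, e', he', by ring⟩)
  rw [Ideal.mem_comap, map_sub, map_one, ← hue]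
  simpa using hu

/-- Split z = z u + z e with u in the contraction and e in d; then z e lies in D ∩ C, hence comes
from the contraction too. -/
theorem map_comap_eq_of_sup_eq_top (hD : ∀ b, b ∈ D ↔ ∃ a ∈ d, f a = b) {C : Ideal B}
    (hC : C ⊔ D = ⊤) : (C.comap f).map f = C := by
  refine le_antisymm Ideal.map_comap_le fun z hz => ?_
  obtain ⟨u, hu, e, he, hue⟩ := Submodule.mem_sup.mp
    ((Ideal.eq_top_iff_one _).mp (comap_sup_eq_top_of_sup_eq_top hD hC))
  have h1 : z = z * f u + z * f e := by rw [← mul_add, ← map_add, hue, map_one, mul_one]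
  obtain ⟨w, -, hw⟩ := (hD (z * f e)).mp (D.mul_mem_left _ ((hD _).mpr ⟨e, he, rfl⟩))
  rw [h1, ← hw]
  refine Ideal.add_mem _ (Ideal.mul_mem_left _ _ (Ideal.mem_map_of_mem f hu))
    (Ideal.mem_map_of_mem f ?_)
  rw [Ideal.mem_comap, hw]
  exact C.mul_mem_right _ hz

theorem pow_sup_eq_top {R : Type*} [CommRing R] {a d : Ideal R} (ha : a ⊔ d = ⊤) (n : ℕ) :
    a ^ n ⊔ d = ⊤ :=
  Ideal.isCoprime_iff_sup_eq.mp (Ideal.isCoprime_iff_sup_eq.mpr ha).pow_left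

theorem isUnit_mk_iff {R : Type*} [CommRing R] {D : Ideal R} {x : R} :
    IsUnit (Ideal.Quotient.mk D x) ↔ Ideal.span {x} ⊔ D = ⊤ := by
  rw [isUnit_iff_exists_inv', Ideal.eq_top_iff_one, Ideal.Quotient.mk_surjective.exists]
  simp only [Submodule.mem_sup, Ideal.mem_span_singleton']
  constructor
  · rintro ⟨y, hy⟩
    rw [← map_mul, ← map_one (Ideal.Quotient.mk D), Ideal.Quotient.eq] at hy
    exact ⟨y * x, ⟨y, rfl⟩, -(y * x - 1), D.neg_mem hy, by ring⟩
  · rintro ⟨_, ⟨y, rfl⟩, z, hz, h⟩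
    refine ⟨y, ?_⟩
    rw [← map_mul, ← map_one (Ideal.Quotient.mk D), Ideal.Quotient.eq, ← h]
    simpa using hz

/-- A power of an element that is a unit modulo `D` is congruent to `1`, if `B ⧸ D` is finite. -/
theorem exists_pow_sub_one_mem [Finite (B ⧸ D)] {x : B} (hx : IsUnit (Ideal.Quotient.mk D x)) :
    ∃ n : ℕ, x ^ (n + 1) - 1 ∈ D := by
  obtain ⟨u, hu⟩ := hx
  obtain ⟨n, hn, h⟩ := (isOfFinOrder_of_finite u).exists_pow_eq_one
  obtain ⟨n, rfl⟩ := Nat.exists_eq_succ_of_ne_zero hn.ne'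
  refine ⟨n, ?_⟩
  rw [← Ideal.Quotient.eq, map_pow, ← hu, ← Units.val_pow_eq_pow_val, h, map_one, Units.val_one]

/-- The contraction of an ideal coprime to `D` that is of finite order in the class group
is of finite order in the class group. -/
theorem exists_comap_pow_eq_span (hf : Function.Injective f)
    (hD : ∀ b, b ∈ D ↔ ∃ a ∈ d, f a = b) [Finite (B ⧸ D)] {C : Ideal B} (hC : C ⊔ D = ⊤)
    {h : ℕ} (hh : h ≠ 0) {x : B} (hx : C ^ h = Ideal.span {x}) :
    ∃ k : ℕ, ∃ c : A, C.comap f ^ (k + 1) = Ideal.span {c} := by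
  have hxu : IsUnit (Ideal.Quotient.mk D x) := by
    rw [isUnit_mk_iff, ← hx]
    exact pow_sup_eq_top hC h
  -- A power of the generator x is 1 modulo D, so it lies in the image of A. It generates the
  -- corresponding power of the contraction, as can be checked after extension.
  obtain ⟨n, hn⟩ := exists_pow_sub_one_mem hxu
  obtain ⟨e, he, hxe⟩ := (hD _).mp hn
  obtain ⟨k, hk⟩ := Nat.exists_eq_succ_of_ne_zero (mul_ne_zero hh n.succ_ne_zero)
  refine ⟨k, e + 1, ?_⟩
  apply eq_of_map_eq_map_of_sup_eq_top hf hD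
  · exact pow_sup_eq_top (comap_sup_eq_top_of_sup_eq_top hD hC) _
  · rw [← isUnit_mk_iff, map_add, Ideal.Quotient.eq_zero_iff_mem.mpr he]
    simp
  · rw [Ideal.map_pow, map_comap_eq_of_sup_eq_top hD hC, Ideal.map_span, Set.image_singleton,
      map_add, hxe, map_one, sub_add_cancel, ← Ideal.span_singleton_pow, ← hx, ← pow_mul]
    congr 1
    exact hk.symm

end SharedIdeal

/-! ### The ideal (m : 𝓞_K): nonzero, of finite index, shared by both rings. -/

section ColonIdeal

open IsNumberFieldOrder

variable {K : Type*} [Field K] (O : Subring K) (m : Ideal O)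

theorem colonIdealOrder_le : colonIdealOrder O m ≤ m := by
  intro x hx
  obtain ⟨z, hz, h⟩ := exists_mem_of_mem_colonMaximalOrder O m hx
  rwa [← Subtype.ext h]

variable [NumberField K] [IsNumberFieldOrder O]

theorem inclusion_injective : Function.Injective (inclusion O) := by
  intro x y h
  exact Subtype.ext (congrArg (fun z : 𝓞 K => (z : K)) h)

/-- This is the hypothesis `hD` of the shared-ideal lemmas. -/
theorem mem_colonIdealMax_iff (b : 𝓞 K) :
    b ∈ colonIdealMax O m ↔ ∃ a ∈ colonIdealOrder O m, inclusion O a = b := by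
  constructor
  · intro hb
    obtain ⟨z, hz, h⟩ := exists_mem_of_mem_colonMaximalOrder O m hb
    refine ⟨z, ?_, NumberField.RingOfIntegers.ext h⟩
    change (z : K) ∈ colonMaximalOrder O m
    rw [h]
    exact hb
  · rintro ⟨a, ha, rfl⟩
    exact ha

theorem exists_natCast_mem {I : Ideal O} (hI : I ≠ ⊥) : ∃ n : ℕ, n ≠ 0 ∧ (n : O) ∈ I := by
  have hfin := IsNumberFieldOrder.finite (O := O)
  have hint : Algebra.IsIntegral ℤ O := inferInstance
  obtain ⟨x, hx, hx0⟩ := Submodule.exists_mem_ne_zero_of_ne_bot hI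
  have h := Ideal.comap_ne_bot_of_integral_mem (R := ℤ) hx0 hx (hint.isIntegral x)
  obtain ⟨n, hn, hn0⟩ := Submodule.exists_mem_ne_zero_of_ne_bot h
  refine ⟨n.natAbs, Int.natAbs_ne_zero.mpr hn0, ?_⟩
  have hn' : ((n : ℤ) : O) ∈ I := by simpa using hn
  rcases Int.natAbs_eq n with h | h <;> rw [h] at hn'
  · simpa using hn'
  · simpa using hn'

/-- A common denominator exists because 𝓞_K is finitely generated over ℤ: multiply denominators of
the generators. -/
theorem exists_natCast_mul_mem : ∃ n : ℕ, n ≠ 0 ∧ ∀ y : 𝓞 K, ∃ z : O, (z : K) = n * y := by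
  classical
  have hspan : (⊤ : Submodule ℤ (𝓞 K)).FG := Module.Finite.fg_top
  obtain ⟨s, hs⟩ := hspan
  have hfrac : ∀ y : K, ∃ n : ℕ, n ≠ 0 ∧ ∃ z : O, (z : K) = n * y := by
    intro y
    obtain ⟨a, b, hb, rfl⟩ := IsFractionRing.div_surjective (A := O) y
    have hb0 : b ≠ 0 := nonZeroDivisors.ne_zero hb
    obtain ⟨n, hn, hnb⟩ := exists_natCast_mem O
      (show Ideal.span {b} ≠ ⊥ by simpa [Ideal.span_singleton_eq_bot] using hb0)
    obtain ⟨c, hc⟩ := Ideal.mem_span_singleton'.mp hnb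
    refine ⟨n, hn, c * a, ?_⟩
    have hc' : (c : K) * b = n := by
      have := congrArg (fun t : O => (t : K)) hc
      simpa using this
    have hbK : (b : K) ≠ 0 := by simpa using hb0
    rw [← hc']
    change ((c * a : O) : K) = c * b * ((a : K) / b)
    push_cast
    field_simp
  choose g hg0 hg using fun y : 𝓞 K => hfrac (y : K)
  refine ⟨∏ y ∈ s, g y, Finset.prod_ne_zero_iff.mpr fun y _ => hg0 y, fun y => ?_⟩
  have hy : y ∈ Submodule.span ℤ (s : Set (𝓞 K)) := hs ▸ Submodule.mem_top
  induction hy using Submodule.span_induction with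
  | mem y hy =>
    obtain ⟨z, hz⟩ := hg y
    refine ⟨(∏ x ∈ s.erase y, g x : ℕ) * z, ?_⟩
    rw [← Finset.prod_erase_mul s g hy]
    push_cast [hz]
    ring
  | zero => exact ⟨0, by simp⟩
  | add x y _ _ hx hy =>
    obtain ⟨u, hu⟩ := hx
    obtain ⟨v, hv⟩ := hy
    exact ⟨u + v, by push_cast [hu, hv]; ring⟩
  | smul k x _ hx =>
    obtain ⟨u, hu⟩ := hx
    refine ⟨k * u, ?_⟩
    push_cast [hu, zsmul_eq_mul]
    simp only [map_intCast]
    ring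

variable {m}

theorem colonIdealOrder_ne_bot (hm : m ≠ ⊥) : colonIdealOrder O m ≠ ⊥ := by
  obtain ⟨n, hn, h⟩ := exists_natCast_mul_mem O
  obtain ⟨x, hx, hx0⟩ := Submodule.exists_mem_ne_zero_of_ne_bot hm
  refine (Submodule.ne_bot_iff _).mpr ⟨n * x, fun y => ?_, mul_ne_zero (by exact_mod_cast hn) hx0⟩
  obtain ⟨z, hz⟩ := h y
  exact ⟨z * x, m.mul_mem_left _ hx, by push_cast [hz]; ring⟩

theorem finite_quotient_colonIdealMax (hm : m ≠ ⊥) : Finite (𝓞 K ⧸ colonIdealMax O m) := by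
  refine Ideal.finiteQuotientOfFreeOfNeBot _ ?_
  obtain ⟨x, hx, hx0⟩ := Submodule.exists_mem_ne_zero_of_ne_bot (colonIdealOrder_ne_bot O hm)
  refine (Submodule.ne_bot_iff _).mpr ⟨inclusion O x, hx, ?_⟩
  exact (map_ne_zero_iff _ (inclusion_injective O)).mpr hx0

variable (m) in
/-- The map from `O ⧸ (m : 𝓞 K)` to `𝓞 K ⧸ (m : 𝓞 K)`. -/
noncomputable def colonQuotientMap :
    O ⧸ colonIdealOrder O m →+* 𝓞 K ⧸ colonIdealMax O m :=
  Ideal.quotientMap _ (inclusion O) (fun _ h => h)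

@[simp]
theorem colonQuotientMap_mk (a : O) :
    colonQuotientMap O m (Ideal.Quotient.mk _ a) = Ideal.Quotient.mk _ (inclusion O a) := rfl

theorem colonQuotientMap_injective : Function.Injective (colonQuotientMap O m) :=
  Ideal.quotientMap_injective' fun _ h => h

theorem finite_quotient_colonIdealOrder (hm : m ≠ ⊥) : Finite (O ⧸ colonIdealOrder O m) :=
  have := finite_quotient_colonIdealMax O hm
  Finite.of_injective _ (colonQuotientMap_injective O)

end ColonIdeal

/-! ### Invertible means dividing a nonzero principal ideal. -/

section Invertible

open FractionalIdeal

variable {K : Type*} [Field K] {R : Type*} [CommRing R] [Algebra R K]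

theorem ne_zero_of_coe_eq {I : (FractionalIdeal R⁰ K)ˣ} {a : Ideal R}
    (h : (I : FractionalIdeal R⁰ K) = a) : a ≠ ⊥ := by
  rintro rfl
  exact I.ne_zero (by rw [h, coeIdeal_bot])

variable [IsFractionRing R K]

theorem isUnit_of_mul_eq_span {a a' : Ideal R} {n : R} (hn : n ≠ 0) (ha : a * a' = Ideal.span {n}) :
    IsUnit (a : FractionalIdeal R⁰ K) := by
  have hnK : algebraMap R K n ≠ 0 := by simpa using hn
  refine IsUnit.of_mul_eq_one (a' * spanSingleton R⁰ (algebraMap R K n)⁻¹) ?_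
  rw [← mul_assoc, ← coeIdeal_mul, ha, coeIdeal_span_singleton, spanSingleton_mul_spanSingleton,
    mul_inv_cancel₀ hnK, spanSingleton_one]

variable [IsDomain R]

/-- An invertible integral ideal divides a nonzero principal ideal. -/
theorem exists_mul_eq_span_of_isUnit {a : Ideal R}
    (ha : IsUnit (a : FractionalIdeal R⁰ K)) :
    ∃ (a' : Ideal R) (n : R), n ≠ 0 ∧ a * a' = Ideal.span {n} := by
  obtain ⟨u, hu⟩ := ha
  obtain ⟨n, a', hn, h⟩ :=
    exists_eq_spanSingleton_mul ((u⁻¹ : (FractionalIdeal R⁰ K)ˣ) : FractionalIdeal R⁰ K)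
  have hnK : algebraMap R K n ≠ 0 := by simpa using hn
  refine ⟨a', n, hn, ?_⟩
  apply coeIdeal_injective (K := K)
  change ((a * a' : Ideal R) : FractionalIdeal R⁰ K) = (Ideal.span {n} : Ideal R)
  rw [coeIdeal_mul, coeIdeal_span_singleton]
  calc (a : FractionalIdeal R⁰ K) * a'
      = spanSingleton R⁰ (algebraMap R K n) *
          (a * (spanSingleton R⁰ (algebraMap R K n)⁻¹ * a')) := by
        rw [mul_left_comm, ← mul_assoc (spanSingleton _ _) (spanSingleton _ _),
          spanSingleton_mul_spanSingleton, mul_inv_cancel₀ hnK, spanSingleton_one, one_mul]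
    _ = _ := by rw [← h, ← hu, u.mul_inv, mul_one]

end Invertible

/-! ### Elementary facts on coprime fractional ideals. -/

section Coprime

variable {K : Type*} [Field K] {O : Subring K}

theorem mem_coprimeFractionalIdeals_of_coe_eq {I : (FractionalIdeal O⁰ K)ˣ} {a : Ideal O}
    {m : Ideal O} (h : (I : FractionalIdeal O⁰ K) = a) (ha : a ⊔ m = ⊤) :
    I ∈ coprimeFractionalIdeals O m :=
  fractionalCoprime_iff.mpr ⟨a, ⊤, ha, by simp, by simp, by simp [h]⟩

theorem coprimeFractionalIdeals_mono {d m : Ideal O} (h : d ≤ m) :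
    coprimeFractionalIdeals O d ≤ coprimeFractionalIdeals O m := by
  intro I hI
  obtain ⟨a, b, ha, hb, hu, hab⟩ := fractionalCoprime_iff.mp hI
  exact fractionalCoprime_iff.mpr ⟨a, b, top_unique (ha ▸ sup_le_sup_left h a),
    top_unique (hb ▸ sup_le_sup_left h b), hu, hab⟩

end Coprime

/-! ### Extension of ideals to the maximal order. -/

section Extension

open IsNumberFieldOrder FractionalIdeal

variable {K : Type*} [Field K] [NumberField K] (O : Subring K) [IsNumberFieldOrder O]

theorem nonZeroDivisors_le_comap_inclusion : O⁰ ≤ (𝓞 K)⁰.comap (inclusion O) :=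
  nonZeroDivisors_le_comap_nonZeroDivisors_of_injective _ (inclusion_injective O)

/-- The extension of invertible fractional ideals of `O` to the maximal order. -/
noncomputable def extendUnits : (FractionalIdeal O⁰ K)ˣ →* (FractionalIdeal (𝓞 K)⁰ K)ˣ :=
  Units.map (extendedHom' (K := K) K (nonZeroDivisors_le_comap_inclusion O)).toMonoidHom

theorem coe_extendUnits (I : (FractionalIdeal O⁰ K)ˣ) :
    (extendUnits O I : FractionalIdeal (𝓞 K)⁰ K) =
      extended K (nonZeroDivisors_le_comap_inclusion O) (I : FractionalIdeal O⁰ K) := rfl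

theorem coe_extendUnits_of_coe_eq {I : (FractionalIdeal O⁰ K)ˣ} {a : Ideal O}
    (h : (I : FractionalIdeal O⁰ K) = a) :
    (extendUnits O I : FractionalIdeal (𝓞 K)⁰ K) = (a.map (inclusion O) : Ideal (𝓞 K)) := by
  rw [coe_extendUnits, h, extended_coeIdeal_eq_map]

theorem extendUnits_toPrincipalIdeal (x : Kˣ) :
    extendUnits O (toPrincipalIdeal O K x) = toPrincipalIdeal (𝓞 K) K x := by
  apply Units.ext
  rw [coe_extendUnits, coe_toPrincipalIdeal, coe_toPrincipalIdeal, extended_spanSingleton]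
  have h : IsLocalization.map K (inclusion O) (nonZeroDivisors_le_comap_inclusion O) =
      RingHom.id K := by
    refine IsLocalization.ringHom_ext O⁰ (RingHom.ext fun a => ?_)
    rw [IsLocalization.map_comp]
    rfl
  rw [h]
  rfl

variable {O}

variable (m : Ideal O)

/-- Extension to the maximal order is injective on the fractional ideals coprime to
`(m : 𝓞 K)`. -/
theorem eq_one_of_extendUnits_eq_one {I : (FractionalIdeal O⁰ K)ˣ}
    (hI : I ∈ coprimeFractionalIdeals O (colonIdealOrder O m)) (h : extendUnits O I = 1) :
    I = 1 := by
  obtain ⟨a, b, ha, hb, ⟨u, hu⟩, hab⟩ := fractionalCoprime_iff.mp hI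
  have h1 : ((I * u : (FractionalIdeal O⁰ K)ˣ) : FractionalIdeal O⁰ K) = a := by
    rw [Units.val_mul, hu, hab]
  have h2 := coe_extendUnits_of_coe_eq O h1
  rw [map_mul, h, one_mul, coe_extendUnits_of_coe_eq O hu] at h2
  -- With I = a / b, triviality of the extension says that a and b extend to the same ideal.
  have hba : b = a := eq_of_map_eq_map_of_sup_eq_top (inclusion_injective O)
    (mem_colonIdealMax_iff O m) hb ha (coeIdeal_injective h2)
  have h3 : I * u = u := Units.ext (by rw [h1, hu, hba])
  exact mul_eq_right.mp h3

variable {m}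

/-- Integral ideals of the maximal order coprime to `(m : 𝓞 K)` are extended from
invertible ideals of `O`. -/
theorem exists_extendUnits_eq (hm : m ≠ ⊥) {C : Ideal (𝓞 K)} (hC0 : C ≠ ⊥)
    (hC : C ⊔ colonIdealMax O m = ⊤) :
    ∃ I ∈ coprimeFractionalIdeals O (colonIdealOrder O m),
      (extendUnits O I : FractionalIdeal (𝓞 K)⁰ K) = C := by
  have := finite_quotient_colonIdealMax O hm
  have hD := mem_colonIdealMax_iff O m
  have hCmem : C ∈ (Ideal (𝓞 K))⁰ := mem_nonZeroDivisors_of_ne_zero hC0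
  -- Finiteness of the class group makes a power of C principal. Then a power of the contraction is
  -- principal, and so the contraction is invertible.
  obtain ⟨x, hx⟩ : ∃ x, C ^ Fintype.card (ClassGroup (𝓞 K)) = Ideal.span {x} := by
    have h1 := pow_card_eq_one (x := ClassGroup.mk0 ⟨C, hCmem⟩)
    rw [← map_pow] at h1
    have h2 := (ClassGroup.mk0_eq_one_iff (pow_mem hCmem _)).mp h1
    exact ⟨_, (Ideal.span_singleton_generator _).symm⟩
  obtain ⟨k, c, hc⟩ := exists_comap_pow_eq_span (inclusion_injective O) hD hC
    Fintype.card_ne_zero hx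
  have hmap := map_comap_eq_of_sup_eq_top hD hC
  have hc0 : c ≠ 0 := by
    rintro rfl
    rw [Ideal.span_singleton_eq_bot.mpr rfl] at hc
    have h3 : C.comap (inclusion O) = ⊥ := by
      simpa using pow_eq_zero_iff (k.succ_ne_zero) |>.mp hc
    rw [h3, Ideal.map_bot] at hmap
    exact hC0 hmap.symm
  obtain ⟨u, hu⟩ := isUnit_of_mul_eq_span (K := K) hc0 (by rw [← hc, pow_succ'])
  refine ⟨u, mem_coprimeFractionalIdeals_of_coe_eq hu (comap_sup_eq_top_of_sup_eq_top hD hC), ?_⟩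
  rw [coe_extendUnits_of_coe_eq O hu, hmap]

end Extension

/-! ### Moving ideals within a class to be coprime to d. -/

section Moving

open IsNumberFieldOrder FractionalIdeal Filter

variable {K : Type*} [Field K] [NumberField K]

/-- ρ(x + k n) ρ(n) = ρ(x) ρ(n) + k ρ(n)² tends to infinity. With n in an ideal, this imposes the
signs of n on x without changing its residue class. -/
theorem eventually_add_mul_ne_zero_and_pos (S : Finset (K →+* ℝ)) (x : K) {n : K} (hn : n ≠ 0) :
    ∀ᶠ k : ℕ in atTop, x + k * n ≠ 0 ∧ ∀ ρ ∈ S, 0 < ρ (x + k * n) * ρ n := by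
  refine Eventually.and ?_ ((eventually_all_finset S).mpr fun ρ _ => ?_)
  · rw [← Nat.cofinite_eq_atTop]
    refine Set.Subsingleton.finite fun k hk l hl => ?_
    simp only [Set.mem_compl_iff, Set.mem_ofPred_eq, not_not] at hk hl
    have h : (k : K) * n = l * n := by linear_combination hk - hl
    exact_mod_cast mul_right_cancel₀ hn h
  · have hρ : 0 < ρ n * ρ n := mul_self_pos.mpr ((map_ne_zero ρ).mpr hn)
    have h : Tendsto (fun k : ℕ => ρ x * ρ n + k * (ρ n * ρ n)) atTop atTop :=
      tendsto_atTop_add_const_left _ _ (tendsto_natCast_atTop_atTop.atTop_mul_const hρ)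
    filter_upwards [h.eventually_gt_atTop 0] with k hk
    simpa [add_mul, mul_assoc] using hk

variable {O : Subring K} [IsNumberFieldOrder O] {m d : Ideal O}

theorem span_singleton_add_sup {R : Type*} [CommRing R] {I : Ideal R} {x y : R} (hy : y ∈ I) :
    Ideal.span {x + y} ⊔ I = Ideal.span {x} ⊔ I := by
  refine le_antisymm (sup_le ?_ le_sup_right) (sup_le ?_ le_sup_right) <;>
    rw [Ideal.span_singleton_le_iff_mem]
  · exact add_mem (Ideal.mem_sup_left (Ideal.mem_span_singleton_self x)) (Ideal.mem_sup_right hy)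
  · have h := sub_mem (Ideal.mem_sup_left (Ideal.mem_span_singleton_self (x + y)) :
      x + y ∈ Ideal.span {x + y} ⊔ I) (Ideal.mem_sup_right hy)
    rwa [add_sub_cancel_right] at h

/-- The moving lemma: the class of a is that of c⁻¹, with c coprime to d. Adding a large multiple of
a positive integer l in a d to the x from `exists_mem_sup_mul_eq` makes it positive at S, and
neither x modulo m nor span {x} + a d changes. -/
theorem exists_mul_eq_span_of_coprime (S : Finset (K →+* ℝ)) [Finite (O ⧸ d)] (hd : d ≠ ⊥)
    (hdm : d ≤ m) {a : Ideal O} (ha0 : a ≠ ⊥) (ham : a ⊔ m = ⊤)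
    (ha : IsUnit (a : FractionalIdeal O⁰ K)) :
    ∃ x : O, x ≠ 0 ∧ x - 1 ∈ m ∧ (∀ ρ ∈ S, 0 < ρ (x : K)) ∧
      ∃ c : Ideal O, c * a = Ideal.span {x} ∧ c ⊔ d = ⊤ := by
  obtain ⟨a', n, hn, han⟩ := exists_mul_eq_span_of_isUnit ha
  obtain ⟨x, hxa, hxm, hx⟩ := exists_mem_sup_mul_eq hn han ham (d := d)
  obtain ⟨l, hl, hlmem⟩ := exists_natCast_mem O (mul_ne_zero ha0 hd : a * d ≠ 0)
  obtain ⟨k, hk0, hk⟩ := (eventually_add_mul_ne_zero_and_pos S (x : K) (n := (l : K))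
    (by exact_mod_cast hl)).exists
  have hkl : (k : O) * l ∈ a * d := Ideal.mul_mem_left _ _ hlmem
  refine ⟨x + k * l, fun h => hk0 ?_, ?_, ?_, ?_⟩
  · have := congrArg (fun t : O => (t : K)) h
    simpa using this
  · rw [add_sub_right_comm]
    exact m.add_mem hxm (hdm (Ideal.mul_le_right hkl))
  · intro ρ hρ
    have hlρ : 0 < ρ (l : K) := by simpa using Nat.pos_of_ne_zero hl
    simpa using (pos_iff_pos_of_mul_pos (hk ρ hρ)).mpr hlρ
  · refine exists_mul_eq_span_of_sup_mul_eq hn han ?_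
    rw [span_singleton_add_sup hkl, hx]

theorem mem_sup_of_coe_eq (S : Finset (K →+* ℝ)) [Finite (O ⧸ d)] (hd : d ≠ ⊥) (hdm : d ≤ m)
    {U : (FractionalIdeal O⁰ K)ˣ} {a : Ideal O} (h : (U : FractionalIdeal O⁰ K) = a)
    (ha : a ⊔ m = ⊤) :
    U ∈ coprimeFractionalIdeals O d ⊔ principalRayIdeals O m S := by
  obtain ⟨x, hx0, hxm, hxS, c, hc, hcd⟩ := exists_mul_eq_span_of_coprime S hd hdm
    (ne_zero_of_coe_eq h) ha ⟨U, h⟩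
  obtain ⟨W, hW⟩ := isUnit_of_mul_eq_span (K := K) hx0 hc
  have hx0' : (x : K) ≠ 0 := by simpa using hx0
  have hUW : W * U = toPrincipalIdeal O K (Units.mk0 (x : K) hx0') := by
    apply Units.ext
    rw [Units.val_mul, hW, h, ← coeIdeal_mul, hc, coeIdeal_span_singleton, coe_toPrincipalIdeal]
    rfl
  rw [eq_inv_mul_of_mul_eq hUW]
  have hxP : Units.mk0 (x : K) hx0' ∈ congrOneSubgroup O m ⊓ positiveAt S :=
    ⟨rayCongr_one_iff.mpr ⟨x, 1, one_ne_zero, by simp, by simp, hxm⟩, hxS⟩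
  exact Subgroup.mul_mem_sup (inv_mem (mem_coprimeFractionalIdeals_of_coe_eq hW hcd))
    ⟨_, hxP, rfl⟩

/-- Every ray class contains ideals coprime to `d`. -/
theorem coprimeFractionalIdeals_sup_principalRayIdeals (S : Finset (K →+* ℝ)) [Finite (O ⧸ d)]
    (hd : d ≠ ⊥) (hdm : d ≤ m) :
    coprimeFractionalIdeals O d ⊔ principalRayIdeals O m S = coprimeFractionalIdeals O m := by
  refine le_antisymm
    (sup_le (coprimeFractionalIdeals_mono hdm) (principalRayIdeals_le O m S)) fun I hI => ?_
  obtain ⟨a, b, ha, hb, ⟨u, hu⟩, h⟩ := fractionalCoprime_iff.mp hI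
  rw [← hu, ← Units.val_mul] at h
  rw [← mul_inv_cancel_right I u]
  exact mul_mem (mem_sup_of_coe_eq S hd hdm h ha) (inv_mem (mem_sup_of_coe_eq S hd hdm hu hb))

theorem index_range_toPrincipalIdeal :
    (toPrincipalIdeal (𝓞 K) K).range.index = NumberField.classNumber K := by
  rw [Subgroup.index, NumberField.classNumber, ← Nat.card_eq_fintype_card]
  exact Nat.card_congr (ClassGroup.equiv K).toEquiv.symm

theorem exists_isCoprime_mul_eq_span {R : Type*} [CommRing R] [IsDomain R] {a a' D : Ideal R}
    {n : R} (hn : n ≠ 0) (ha : a * a' = Ideal.span {n}) [Finite (R ⧸ D)] :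
    ∃ x : R, x ≠ 0 ∧ ∃ c : Ideal R, c * a = Ideal.span {x} ∧ c ⊔ D = ⊤ := by
  have ha0 : a ≠ ⊥ := by
    rintro rfl
    rw [Ideal.bot_mul] at ha
    exact hn (Ideal.span_singleton_eq_bot.mp ha.symm)
  obtain ⟨x, hxa, -, hx⟩ := exists_mem_sup_mul_eq hn ha (m := ⊤) (d := D) (by simp)
  by_cases hx0 : x = 0
  -- If x = 0 generates a modulo a D, then a D = a, and any nonzero element of a serves.
  · obtain ⟨y, hy, hy0⟩ := Submodule.exists_mem_ne_zero_of_ne_bot ha0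
    refine ⟨y, hy0, ?_⟩
    refine exists_mul_eq_span_of_sup_mul_eq hn ha ?_
    have h : a * D = a := by simpa [hx0, Ideal.span_singleton_eq_bot.mpr] using hx
    rw [h]
    exact sup_eq_right.mpr ((Ideal.span_singleton_le_iff_mem _).mpr hy)
  · exact ⟨x, hx0, exists_mul_eq_span_of_sup_mul_eq hn ha hx⟩

/-- Every ideal class of the maximal order is represented by the extension of an invertible
ideal of `O` coprime to `(m : 𝓞 K)`. -/
theorem range_toPrincipalIdeal_sup_map (hm : m ≠ ⊥) :
    (coprimeFractionalIdeals O (colonIdealOrder O m)).map (extendUnits O) ⊔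
      (toPrincipalIdeal (𝓞 K) K).range = ⊤ := by
  have := finite_quotient_colonIdealMax O hm
  refine top_unique fun I _ => ?_
  obtain ⟨n, a, hn, h⟩ := exists_eq_spanSingleton_mul
    ((I⁻¹ : (FractionalIdeal (𝓞 K)⁰ K)ˣ) : FractionalIdeal (𝓞 K)⁰ K)
  have hnK : algebraMap (𝓞 K) K n ≠ 0 := by simpa using hn
  -- The inverse of I is made integral, so that its cofactor c coprime to D lies in the class of I
  -- itself.
  have hA : ((toPrincipalIdeal (𝓞 K) K (Units.mk0 _ hnK) * I⁻¹ :
      (FractionalIdeal (𝓞 K)⁰ K)ˣ) : FractionalIdeal (𝓞 K)⁰ K) = a := by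
    rw [Units.val_mul, h, coe_toPrincipalIdeal, ← mul_assoc, spanSingleton_mul_spanSingleton,
      Units.val_mk0, mul_inv_cancel₀ hnK, spanSingleton_one, one_mul]
  obtain ⟨a', l, hl, hal⟩ := exists_mul_eq_span_of_isUnit (K := K) ⟨_, hA⟩
  obtain ⟨x, hx0, c, hc, hcD⟩ := exists_isCoprime_mul_eq_span (D := colonIdealMax O m) hl hal
  have hc0 : c ≠ ⊥ := by
    rintro rfl
    rw [Ideal.bot_mul] at hc
    exact hx0 (Ideal.span_singleton_eq_bot.mp hc.symm)
  obtain ⟨J, hJ, hJc⟩ := exists_extendUnits_eq hm hc0 hcD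
  have hxK : algebraMap (𝓞 K) K x ≠ 0 := by simpa using hx0
  have key : extendUnits O J * (toPrincipalIdeal (𝓞 K) K (Units.mk0 _ hnK) * I⁻¹) =
      toPrincipalIdeal (𝓞 K) K (Units.mk0 _ hxK) := by
    apply Units.ext
    rw [Units.val_mul, hJc, hA, ← coeIdeal_mul, hc, coeIdeal_span_singleton, coe_toPrincipalIdeal]
    rfl
  rw [← mul_assoc, mul_inv_eq_iff_eq_mul] at key
  rw [← inv_mul_eq_iff_eq_mul.mpr key, mul_left_comm]
  exact Subgroup.mul_mem_sup ⟨J, hJ, rfl⟩ (mul_mem (inv_mem ⟨_, rfl⟩) ⟨_, rfl⟩)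

end Moving

/-! ### Generators as quotients of elements coprime to d. -/

section CoprimeElements

open FractionalIdeal

variable {K : Type*} [Field K] {R : Type*} [CommRing R]

theorem exists_mem_ne_zero_sub_one_mem {b d : Ideal R} (hb : b ⊔ d = ⊤) (hb0 : b ≠ ⊥) :
    ∃ y ∈ b, y ≠ 0 ∧ y - 1 ∈ d := by
  obtain ⟨y, hy, e, he, hye⟩ := Submodule.mem_sup.mp ((Ideal.eq_top_iff_one _).mp hb)
  by_cases hy0 : y = 0
  · obtain ⟨z, hz, hz0⟩ := Submodule.exists_mem_ne_zero_of_ne_bot hb0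
    rw [hy0, zero_add] at hye
    exact ⟨z, hz, hz0, by rw [(Ideal.eq_top_iff_one d).mpr (hye ▸ he)]; trivial⟩
  · refine ⟨y, hy, hy0, ?_⟩
    rw [← hye, sub_add_cancel_left]
    exact d.neg_mem he

variable [Algebra R K] [IsFractionRing R K]

theorem toPrincipalIdeal_eq_one_iff {α : Kˣ} : toPrincipalIdeal R K α = 1 ↔
    ∃ u : Rˣ, Units.map (algebraMap R K : R →* K) u = α := by
  have key : ∀ α : Kˣ, toPrincipalIdeal R K α = 1 → ∃ x : R, algebraMap R K x = α := by
    intro α h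
    have h1 : (α : K) ∈ (1 : FractionalIdeal R⁰ K) := by
      rw [← Units.val_one, ← h, coe_toPrincipalIdeal]
      exact mem_spanSingleton_self _ _
    exact mem_one_iff _ |>.mp h1
  constructor
  · intro h
    obtain ⟨x, hx⟩ := key α h
    obtain ⟨y, hy⟩ := key α⁻¹ (by rw [map_inv, h, inv_one])
    have hxy : x * y = 1 := by
      apply IsFractionRing.injective R K
      rw [map_mul, hx, hy, map_one, Units.mul_inv]
    exact ⟨⟨x, y, hxy, by rw [mul_comm, hxy]⟩, Units.ext hx⟩
  · rintro ⟨u, rfl⟩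
    apply Units.ext
    rw [coe_toPrincipalIdeal, Units.coe_map, MonoidHom.coe_coe, ← coeIdeal_span_singleton,
      Ideal.span_singleton_eq_top.mpr u.isUnit, coeIdeal_top, Units.val_one]

/-- If `α R = a / b` with `a` and `b` coprime to `d`, then `α` is a quotient of elements coprime
to `d`. -/
theorem exists_eq_div_of_spanSingleton_mul_eq {a b d : Ideal R} (ha : a ⊔ d = ⊤) (hb : b ⊔ d = ⊤)
    (hb0 : b ≠ ⊥) {α : K}
    (h : spanSingleton R⁰ α * (b : FractionalIdeal R⁰ K) = a) :
    ∃ x y : R, y ≠ 0 ∧ y - 1 ∈ d ∧ Ideal.span {x} ⊔ d = ⊤ ∧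
      α = algebraMap R K x / algebraMap R K y := by
  obtain ⟨y, hyb, hy0, hyd⟩ := exists_mem_ne_zero_sub_one_mem hb hb0
  have hyK : algebraMap R K y ≠ 0 := by simpa using hy0
  have hmem : α * algebraMap R K y ∈ (a : FractionalIdeal R⁰ K) := by
    rw [← h]
    exact mul_mem_mul (mem_spanSingleton_self _ _) (mem_coeIdeal_of_mem _ hyb)
  obtain ⟨x, hxa, hx⟩ := (mem_coeIdeal _).mp hmem
  have hα : α = algebraMap R K x / algebraMap R K y := by
    rw [hx, mul_div_cancel_right₀ _ hyK]
  refine ⟨x, y, hy0, hyd, ?_, hα⟩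
  -- The right side is coprime to d and is contained in span {x}.
  have hxy : Ideal.span {x} * b = Ideal.span {y} * a := by
    apply coeIdeal_injective (K := K)
    change ((Ideal.span {x} * b : Ideal R) : FractionalIdeal R⁰ K) =
      (Ideal.span {y} * a : Ideal R)
    rw [coeIdeal_mul, coeIdeal_mul, coeIdeal_span_singleton, coeIdeal_span_singleton, hx, ← h,
      ← mul_assoc, spanSingleton_mul_spanSingleton, mul_comm α]
  have hy : Ideal.span {y} ⊔ d = ⊤ := by
    rw [← isUnit_mk_iff]
    rw [← Ideal.Quotient.eq] at hyd
    rw [hyd, map_one]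
    exact isUnit_one
  have hya : Ideal.span {y} * a ⊔ d = ⊤ :=
    Ideal.isCoprime_iff_sup_eq.mp ((Ideal.isCoprime_iff_sup_eq.mpr hy).mul_left
      (Ideal.isCoprime_iff_sup_eq.mpr ha))
  rw [← hxy] at hya
  exact top_unique (hya ▸ sup_le_sup_right Ideal.mul_le_left _)

end CoprimeElements

/-! ### Reduction of the class number to an index of subgroups of K^×. -/

section Index

open IsNumberFieldOrder FractionalIdeal

variable {K : Type*} [Field K] [NumberField K] {O : Subring K} [IsNumberFieldOrder O]
  (m : Ideal O)

variable (O) in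
/-- The elements `α` of `Kˣ` for which `α 𝓞_K` is extended from an invertible fractional ideal of
`O` coprime to `(m : 𝓞 K)`. -/
noncomputable def coprimeElements : Subgroup Kˣ :=
  ((coprimeFractionalIdeals O (colonIdealOrder O m)).map (extendUnits O)).comap
    (toPrincipalIdeal (𝓞 K) K)

variable (O) in
/-- The elements `α ≡ 1 (mod m)` of `Kˣ`, positive at `S`, for which the fractional ideal `α O` is
coprime to `(m : 𝓞 K)`. -/
noncomputable def coprimeRayElements (S : Finset (K →+* ℝ)) : Subgroup Kˣ :=
  (congrOneSubgroup O m ⊓ positiveAt S) ⊓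
    (coprimeFractionalIdeals O (colonIdealOrder O m)).comap (toPrincipalIdeal O K)

variable {m}

/-- Normalizing the denominator to be 1 modulo d makes the numerator alone carry the residue of α.
-/
theorem mem_coprimeElements_iff (hm : m ≠ ⊥) {α : Kˣ} : α ∈ coprimeElements O m ↔
    ∃ x y : 𝓞 K, y ≠ 0 ∧ y - 1 ∈ colonIdealMax O m ∧ Ideal.span {x} ⊔ colonIdealMax O m = ⊤ ∧
      (α : K) = x / y := by
  have hD := mem_colonIdealMax_iff O m
  constructor
  · rintro ⟨I, hI, h⟩
    obtain ⟨a, b, ha, hb, ⟨u, hu⟩, hab⟩ := fractionalCoprime_iff.mp hI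
    rw [← hu, ← Units.val_mul] at hab
    have h1 := coe_extendUnits_of_coe_eq O hab
    have h2 := coe_extendUnits_of_coe_eq O hu
    rw [map_mul, h, Units.val_mul, h2, coe_toPrincipalIdeal] at h1
    exact exists_eq_div_of_spanSingleton_mul_eq (map_sup_eq_top_of_sup_eq_top hD ha)
      (map_sup_eq_top_of_sup_eq_top hD hb) (ne_zero_of_coe_eq h2) h1
  · rintro ⟨x, y, hy0, hyd, hx, h⟩
    have hx0 : x ≠ 0 := by
      rintro rfl
      simp at h
    have hy : Ideal.span {y} ⊔ colonIdealMax O m = ⊤ := by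
      rw [← isUnit_mk_iff]
      rw [← Ideal.Quotient.eq] at hyd
      rw [hyd, map_one]
      exact isUnit_one
    obtain ⟨I, hI, hIx⟩ := exists_extendUnits_eq hm
      (by simpa [Ideal.span_singleton_eq_bot] using hx0) hx
    obtain ⟨J, hJ, hJy⟩ := exists_extendUnits_eq hm
      (by simpa [Ideal.span_singleton_eq_bot] using hy0) hy
    refine ⟨I * J⁻¹, mul_mem hI (inv_mem hJ), ?_⟩
    rw [map_mul, map_inv, mul_inv_eq_iff_eq_mul]
    apply Units.ext
    rw [Units.val_mul, hIx, hJy, coeIdeal_span_singleton, coeIdeal_span_singleton,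
      coe_toPrincipalIdeal, spanSingleton_mul_spanSingleton, h, div_mul_cancel₀]
    simpa using hy0

theorem mem_coprimeRayElements_iff {S : Finset (K →+* ℝ)} {α : Kˣ} :
    α ∈ coprimeRayElements O m S ↔ (∃ x y : O, y ≠ 0 ∧ y - 1 ∈ colonIdealOrder O m ∧ x - 1 ∈ m ∧
      Ideal.span {x} ⊔ colonIdealOrder O m = ⊤ ∧ (α : K) = x / y) ∧ ∀ ρ ∈ S, 0 < ρ (α : K) := by
  constructor
  · rintro ⟨⟨hα, hpos⟩, hI⟩
    refine ⟨?_, hpos⟩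
    obtain ⟨a, b, ha, hb, ⟨u, hu⟩, hab⟩ := fractionalCoprime_iff.mp hI
    rw [coe_toPrincipalIdeal] at hab
    obtain ⟨x, y, hy0, hyd, hx, h⟩ :=
      exists_eq_div_of_spanSingleton_mul_eq ha hb (ne_zero_of_coe_eq hu) hab
    refine ⟨x, y, hy0, hyd, ?_, hx, h⟩
    obtain ⟨p, q, hq0, hpq, hq, hpqm⟩ := rayCongr_one_iff.mp hα
    have hyK : (y : K) ≠ 0 := by simpa using hy0
    have hqK : (q : K) ≠ 0 := by simpa using hq0
    have hxq : x * q = p * y := by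
      apply Subtype.ext
      have h2 : (x : K) / y = p / q := h.symm.trans hpq
      rw [div_eq_div_iff hyK hqK] at h2
      exact_mod_cast h2
    obtain ⟨c, hc⟩ := span_singleton_sup_eq_top_iff.mp hq
    -- Modulo m, c inverts q, so x q = p y and p ≡ q give x ≡ y ≡ 1.
    have h3 : x - 1 = c * (y * (p - q)) - (c * q - 1) * (x - y) + (y - 1) := by
      linear_combination c * hxq
    rw [h3]
    exact add_mem (sub_mem (m.mul_mem_left _ (m.mul_mem_left _ hpqm)) (m.mul_mem_right _ hc))
      (colonIdealOrder_le O m hyd)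
  · rintro ⟨⟨x, y, hy0, hyd, hxm, hx, h⟩, hpos⟩
    have hx0 : x ≠ 0 := by
      rintro rfl
      simp at h
    have hyK : (y : K) ≠ 0 := by simpa using hy0
    have hym : y - 1 ∈ m := colonIdealOrder_le O m hyd
    have hy : Ideal.span {y} ⊔ colonIdealOrder O m = ⊤ :=
      span_singleton_sup_eq_top_iff.mpr ⟨1, by simpa using hyd⟩
    refine ⟨⟨rayCongr_one_iff.mpr ⟨x, y, hy0, h,
      span_singleton_sup_eq_top_iff.mpr ⟨1, by simpa using hym⟩, ?_⟩, hpos⟩, ?_⟩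
    · rw [← sub_sub_sub_cancel_right x y 1]
      exact sub_mem hxm hym
    · refine fractionalCoprime_iff.mpr ⟨Ideal.span {x}, Ideal.span {y}, hx, hy,
        isUnit_of_mul_eq_span hy0 (Ideal.mul_top _), ?_⟩
      rw [coeIdeal_span_singleton, coeIdeal_span_singleton, coe_toPrincipalIdeal,
        spanSingleton_mul_spanSingleton, h]
      congr 1
      exact div_mul_cancel₀ _ hyK

/-- If a unit u of 𝓞_K lies in T', then uO is in H and extends to the unit ideal, so uO = O by
injectivity and u is a unit of O. -/
theorem comap_coprimeRayElements (S : Finset (K →+* ℝ)) :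
    (coprimeRayElements O m S).comap (Units.map (algebraMap (𝓞 K) K : 𝓞 K →* K)) =
      (rayUnitGroup O m S).map (Units.map (inclusion O : O →* 𝓞 K)) := by
  have hcomp : ∀ v : Oˣ, Units.map (algebraMap (𝓞 K) K : 𝓞 K →* K)
      (Units.map (inclusion O : O →* 𝓞 K) v) = Units.map (algebraMap O K : O →* K) v :=
    fun v => rfl
  ext u
  constructor
  · rintro ⟨⟨hα, hpos⟩, hI⟩
    have h1 := eq_one_of_extendUnits_eq_one m hI (by
      rw [extendUnits_toPrincipalIdeal]
      exact toPrincipalIdeal_eq_one_iff.mpr ⟨u, rfl⟩)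
    obtain ⟨v, hv⟩ := toPrincipalIdeal_eq_one_iff.mp h1
    have huv : Units.map (inclusion O : O →* 𝓞 K) v = u :=
      Units.map_injective (f := (algebraMap (𝓞 K) K : 𝓞 K →* K))
        (FaithfulSMul.algebraMap_injective (𝓞 K) K) ((hcomp v).trans hv)
    refine ⟨v, mem_rayUnitGroup.mpr ⟨?_, fun ρ hρ => ?_⟩, huv⟩
    · obtain ⟨p, q, hq0, hpq, hq, hpqm⟩ := rayCongr_one_iff.mp hα
      have hqK : (q : K) ≠ 0 := by simpa using hq0
      have hvq : v * q = p := by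
        apply Subtype.ext
        have h2 : ((v : O) : K) = p / q := (congrArg Units.val hv).trans hpq
        rw [eq_div_iff hqK] at h2
        exact_mod_cast h2
      obtain ⟨c, hc⟩ := span_singleton_sup_eq_top_iff.mp hq
      have h3 : (v : O) - 1 = c * (p - q) - (c * q - 1) * (v - 1) := by
        linear_combination c * hvq
      rw [h3]
      exact sub_mem (m.mul_mem_left _ hpqm) (m.mul_mem_right _ hc)
    · have h2 : ((v : O) : K) = _ := congrArg Units.val hv
      rw [h2]
      exact hpos ρ hρ
  · rintro ⟨v, hv, rfl⟩
    obtain ⟨hvm, hpos⟩ := mem_rayUnitGroup.mp hv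
    refine ⟨⟨rayCongr_one_iff.mpr ⟨v, 1, one_ne_zero, ?_, by simp, hvm⟩, hpos⟩, ?_⟩
    · rw [hcomp]
      simp
      rfl
    · change toPrincipalIdeal O K _ ∈ coprimeFractionalIdeals O (colonIdealOrder O m)
      rw [hcomp, toPrincipalIdeal_eq_one_iff.mpr ⟨v, rfl⟩]
      exact one_mem _

theorem relIndex_principalRayIdeals (hm : m ≠ ⊥) (S : Finset (K →+* ℝ)) :
    (principalRayIdeals O m S).relIndex (coprimeFractionalIdeals O m) *
      ((rayUnitGroup O m S).map (Units.map (inclusion O : O →* 𝓞 K))).index =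
    NumberField.classNumber K * (coprimeRayElements O m S).relIndex (coprimeElements O m) := by
  have := finite_quotient_colonIdealOrder O hm
  set H := coprimeFractionalIdeals O (colonIdealOrder O m) with hH
  set P := principalRayIdeals O m S with hP
  set φ := extendUnits O
  set τ := toPrincipalIdeal (𝓞 K) K
  set T := coprimeElements O m
  set T' := coprimeRayElements O m S
  set N := H ⊓ τ.range.comap φ with hN
  set Q := P ⊓ H
  have hφτ : φ.comp (toPrincipalIdeal O K) = τ := MonoidHom.ext (extendUnits_toPrincipalIdeal O)
  have hQ : Q = T'.map (toPrincipalIdeal O K) := by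
    ext I
    constructor
    · rintro ⟨⟨α, hα, rfl⟩, hI⟩
      exact ⟨α, ⟨hα, hI⟩, rfl⟩
    · rintro ⟨α, ⟨hα, hI⟩, rfl⟩
      exact ⟨⟨α, hα, rfl⟩, hI⟩
  have hQN : Q ≤ N := by
    rintro I ⟨⟨α, -, rfl⟩, hI⟩
    exact ⟨hI, α, (extendUnits_toPrincipalIdeal O α).symm⟩
  have h1 : P.relIndex (coprimeFractionalIdeals O m) = Q.relIndex H := by
    rw [← coprimeFractionalIdeals_sup_principalRayIdeals S (colonIdealOrder_ne_bot O hm)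
      (colonIdealOrder_le O m), Subgroup.relIndex_sup_right, Subgroup.inf_relIndex_right]
  have h2 : Q.relIndex N * N.relIndex H = Q.relIndex H :=
    Subgroup.relIndex_mul_relIndex _ _ _ hQN inf_le_left
  have h3 : N.relIndex H = NumberField.classNumber K := by
    rw [hN, Subgroup.inf_relIndex_left, Subgroup.relIndex_comap,
      ← index_range_toPrincipalIdeal (K := K), ← Subgroup.relIndex_top_right,
      ← range_toPrincipalIdeal_sup_map hm, Subgroup.relIndex_sup_right]
  have h4 : Q.relIndex N = (Q.map φ).relIndex (N.map φ) := by
    -- Injectivity of φ on H, phrased so that relative indices can be transported along φ.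
    have hQφ : (Q.map φ).comap φ ⊓ N = Q := by
      refine le_antisymm ?_ (le_inf (Subgroup.le_comap_map φ Q) hQN)
      rintro I ⟨⟨J, hJ, hJI⟩, hI⟩
      have h : J⁻¹ * I = 1 := eq_one_of_extendUnits_eq_one m (mul_mem (inv_mem hJ.2) hI.1)
        (by rw [map_mul, map_inv]; exact inv_mul_eq_one.mpr hJI)
      rwa [← inv_mul_eq_one.mp h]
    rw [← Subgroup.relIndex_comap, ← Subgroup.inf_relIndex_right ((Q.map φ).comap φ), hQφ]
  have hNT : N.map φ = T.map τ := by
    ext I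
    constructor
    · rintro ⟨J, ⟨hJ, α, hα⟩, rfl⟩
      exact ⟨α, ⟨J, hJ, hα.symm⟩, hα⟩
    · rintro ⟨α, ⟨J, hJ, hα⟩, rfl⟩
      exact ⟨J, ⟨hJ, α, hα.symm⟩, hα⟩
  have hker : τ.ker = (Units.map (algebraMap (𝓞 K) K : 𝓞 K →* K)).range := by
    ext α
    exact toPrincipalIdeal_eq_one_iff
  have hkerT : τ.ker ≤ T := by
    intro α hα
    change τ α ∈ H.map φ
    rw [MonoidHom.mem_ker.mp hα]
    exact one_mem _
  have hT'T : T' ≤ T := by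
    rintro α ⟨-, hα⟩
    exact ⟨_, hα, extendUnits_toPrincipalIdeal O α⟩
  have h5 : (Q.map φ).relIndex (N.map φ) = (T' ⊔ τ.ker).relIndex T := by
    rw [hNT, hQ, Subgroup.map_map, hφτ, Subgroup.relIndex_map_map, sup_eq_left.mpr hkerT]
  have h6 : T'.relIndex (T' ⊔ τ.ker) * (T' ⊔ τ.ker).relIndex T = T'.relIndex T :=
    Subgroup.relIndex_mul_relIndex _ _ _ le_sup_left (sup_le hT'T hkerT)
  -- The kernel of τ is 𝓞_K^×, which meets T' in the ray units.
  have h7 : T'.relIndex (T' ⊔ τ.ker) =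
      ((rayUnitGroup O m S).map (Units.map (inclusion O : O →* 𝓞 K))).index := by
    rw [Subgroup.relIndex_sup_left, hker, ← Subgroup.index_comap, comap_coprimeRayElements]
  rw [h1, ← h2, h3, h4, h5, ← h6, h7]
  ring

end Index

/-! ### Signs at real embeddings. -/

section Signs

open NumberField

variable {K : Type*} [Field K]

/-- The signs of an element of `Kˣ` at the real embeddings in `S`. -/
noncomputable def signsAt (S : Finset (K →+* ℝ)) : Kˣ →* (S → SignTypeˣ) :=
  MonoidHom.pi fun ρ => (Units.map ((signHom : ℝ →*₀ SignType) : ℝ →* SignType)).comp (Units.map (ρ.1 : K →* ℝ))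

@[simp]
theorem coe_signsAt_apply (S : Finset (K →+* ℝ)) (α : Kˣ) (ρ : S) :
    (signsAt S α ρ : SignType) = SignType.sign (ρ.1 (α : K)) := rfl

theorem signsAt_eq_one_iff {S : Finset (K →+* ℝ)} {α : Kˣ} :
    signsAt S α = 1 ↔ ∀ ρ ∈ S, 0 < ρ (α : K) := by
  simp only [funext_iff, Units.ext_iff, coe_signsAt_apply, Pi.one_apply, Units.val_one,
    sign_eq_one_iff, Subtype.forall]

theorem natCard_signs (S : Finset (K →+* ℝ)) : Nat.card (S → SignTypeˣ) = 2 ^ S.card := by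
  have h : Nat.card SignTypeˣ = 2 := by
    rw [Nat.card_eq_fintype_card]
    decide
  rw [Nat.card_fun, h, Nat.card_eq_fintype_card, Fintype.card_coe]

theorem sign_eq_of_mul_pos {a b : ℝ} (h : 0 < a * b) : SignType.sign a = SignType.sign b := by
  have h1 : SignType.sign a * SignType.sign b = 1 := by rw [← sign_mul, sign_pos h]
  have h2 : ∀ s t : SignType, s * t = 1 → s = t := by decide
  exact h2 _ _ h1

/-- The infinite place below a real embedding. -/
noncomputable def realPlace (ρ : K →+* ℝ) : InfinitePlace K :=
  InfinitePlace.mk (Complex.ofRealHom.comp ρ)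

theorem realPlace_apply (ρ : K →+* ℝ) (x : K) : realPlace ρ x = |ρ x| := by
  simp [realPlace, InfinitePlace.apply]

/-- A real embedding is its own complex conjugate, so its place determines it. -/
theorem realPlace_injective : Function.Injective (realPlace : (K →+* ℝ) → InfinitePlace K) := by
  intro ρ σ h
  have h' : Complex.ofRealHom.comp ρ = Complex.ofRealHom.comp σ := by
    rcases InfinitePlace.mk_eq_iff.mp h with h | h
    · exact h
    · rw [← h]
      ext x
      simp
  ext x
  have := RingHom.congr_fun h' x
  simpa using this

variable [NumberField K]

/-- Weak approximation: an element within distance 1 of ±1 at a real place has that sign there. -/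
theorem signsAt_surjective (S : Finset (K →+* ℝ)) : Function.Surjective (signsAt S) := by
  classical
  intro ε
  let z : InfinitePlace K → K := fun v => if ∃ ρ : S, realPlace ρ.1 = v ∧ ε ρ = 1 then 1 else -1
  obtain ⟨t, ht⟩ := (InfinitePlace.denseRange_algebraMap_pi K).exists_dist_lt
    (fun v => WithAbs.toAbs v.1 (z v)) one_pos
  have hv : ∀ v : InfinitePlace K, v (z v - t) < 1 := by
    intro v
    have := (dist_le_pi_dist _ _ v).trans_lt ht
    rw [dist_eq_norm] at this
    exact this
  have hsign : ∀ ρ : S, SignType.sign (ρ.1 t) = ε ρ := by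
    intro ρ
    have h := hv (realPlace ρ.1)
    rw [realPlace_apply, abs_lt, map_sub] at h
    by_cases hε : ε ρ = 1
    · have hz : z (realPlace ρ.1) = 1 := if_pos ⟨ρ, rfl, hε⟩
      rw [hz, map_one] at h
      rw [hε, sign_pos (by linarith), Units.val_one]
    · have hz : z (realPlace ρ.1) = -1 := by
        refine if_neg ?_
        rintro ⟨σ, hσ, hσε⟩
        rw [Subtype.ext (realPlace_injective hσ)] at hσε
        exact hε hσε
      rw [hz, map_neg, map_one] at h
      have h2 : ∀ u : SignTypeˣ, u ≠ 1 → (u : SignType) = -1 := by decide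
      rw [h2 _ hε, sign_neg (by linarith)]
  -- Zero has no unit sign, so t = 0 is possible only for empty S.
  by_cases ht0 : t = 0
  · have hS : IsEmpty S := ⟨fun ρ => (ε ρ).ne_zero (by rw [← hsign ρ, ht0, map_zero, sign_zero])⟩
    exact ⟨1, Subsingleton.elim _ _⟩
  · exact ⟨Units.mk0 t ht0, funext fun ρ => Units.ext (hsign ρ)⟩

/-- The residue class and the signs of a nonzero element of the maximal order can be prescribed
independently. -/
theorem exists_sub_mem_and_signsAt_eq {D : Ideal (𝓞 K)} (hD : D ≠ ⊥) (S : Finset (K →+* ℝ))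
    (x : 𝓞 K) (ε : S → SignTypeˣ) :
    ∃ (w : 𝓞 K) (hw : (w : K) ≠ 0), w - x ∈ D ∧ signsAt S (Units.mk0 (w : K) hw) = ε := by
  obtain ⟨t, rfl⟩ := signsAt_surjective S ε
  obtain ⟨a, b, hb, hab⟩ := IsFractionRing.div_surjective (A := 𝓞 K) (t : K)
  obtain ⟨n, hn, hn0⟩ := Submodule.exists_mem_ne_zero_of_ne_bot hD
  have hb0 : (b : K) ≠ 0 := by simpa using nonZeroDivisors.ne_zero hb
  have hn0' : (n : K) ≠ 0 := by simpa using hn0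
  -- This shift lies in D and, differing from t by a square, has the signs of t.
  have hδ : ((a * b * n ^ 2 : 𝓞 K) : K) = t * ((b : K) * n) ^ 2 := by
    rw [← hab]
    push_cast
    field_simp
  have hδ0 : ((a * b * n ^ 2 : 𝓞 K) : K) ≠ 0 := by
    rw [hδ]
    exact mul_ne_zero t.ne_zero (pow_ne_zero _ (mul_ne_zero hb0 hn0'))
  obtain ⟨k, hk0, hk⟩ := (eventually_add_mul_ne_zero_and_pos S (x : K) hδ0).exists
  have hw : ((x + k * (a * b * n ^ 2) : 𝓞 K) : K) = x + k * ((a * b * n ^ 2 : 𝓞 K) : K) := by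
    push_cast
    ring
  refine ⟨x + k * (a * b * n ^ 2), by rwa [hw], ?_, funext fun ρ => Units.ext ?_⟩
  · rw [add_sub_cancel_left, pow_two]
    exact D.mul_mem_left _ (D.mul_mem_left _ (D.mul_mem_left _ hn))
  · rw [coe_signsAt_apply, coe_signsAt_apply, Units.val_mk0, hw]
    rw [sign_eq_of_mul_pos (hk ρ.1 ρ.2), hδ, map_mul, map_pow, sign_mul,
      sign_pos (sq_pos_of_ne_zero ((map_ne_zero ρ.1).mpr (mul_ne_zero hb0 hn0'))), mul_one]

end Signs

/-! ### Residues and signs compute the index [T : T']. -/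

section Residue

open IsNumberFieldOrder

variable {K : Type*} [Field K] [NumberField K] {O : Subring K} [IsNumberFieldOrder O]
  {m : Ideal O}

/-- The residue class map on the elements of `Kˣ` coprime to `(m : 𝓞 K)`. -/
theorem exists_residue (hm : m ≠ ⊥) :
    ∃ θ : coprimeElements O m →* (𝓞 K ⧸ colonIdealMax O m)ˣ,
      ∀ (α : coprimeElements O m) (x y : 𝓞 K), y ≠ 0 → y - 1 ∈ colonIdealMax O m →
        ((α : Kˣ) : K) = x / y → (θ α : 𝓞 K ⧸ colonIdealMax O m) = Ideal.Quotient.mk _ x := by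
  set D := colonIdealMax O m
  choose x y hy0 hyd hx h using fun α : coprimeElements O m => (mem_coprimeElements_iff hm).mp α.2
  -- Independence of the fraction gives both well-definedness and multiplicativity.
  have huniq : ∀ x y x' y' : 𝓞 K, y ≠ 0 → y - 1 ∈ D → y' ≠ 0 → y' - 1 ∈ D →
      (x : K) / y = x' / y' → Ideal.Quotient.mk D x = Ideal.Quotient.mk D x' := by
    intro x y x' y' hy0 hy hy0' hy' h
    rw [div_eq_div_iff (by simpa using hy0) (by simpa using hy0')] at h
    have h1 : x * y' = x' * y := NumberField.RingOfIntegers.ext (by exact_mod_cast h)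
    have h2 := congrArg (Ideal.Quotient.mk D) h1
    rw [← Ideal.Quotient.eq, map_one] at hy hy'
    rwa [map_mul, map_mul, hy, hy', mul_one, mul_one] at h2
  have key : ∀ (α : coprimeElements O m) (x' y' : 𝓞 K), y' ≠ 0 → y' - 1 ∈ D →
      ((α : Kˣ) : K) = x' / y' → Ideal.Quotient.mk D (x α) = Ideal.Quotient.mk D x' :=
    fun α x' y' hy0' hy' h' => huniq _ _ _ _ (hy0 α) (hyd α) hy0' hy' ((h α).symm.trans h')
  refine ⟨MonoidHom.mk' (fun α => (isUnit_mk_iff.mpr (hx α)).unit) fun α β => ?_, key⟩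
  apply Units.ext
  change Ideal.Quotient.mk D (x (α * β)) = Ideal.Quotient.mk D (x α) * Ideal.Quotient.mk D (x β)
  rw [← map_mul]
  refine key _ _ (y α * y β) (mul_ne_zero (hy0 α) (hy0 β)) ?_ ?_
  · have h1 : y α * y β - 1 = y α * (y β - 1) + (y α - 1) := by ring
    rw [h1]
    exact D.add_mem (D.mul_mem_left _ (hyd β)) (hyd α)
  · push_cast
    rw [h α, h β, div_mul_div_comm]

theorem unitsCongrOne_mk_iff {R : Type*} [CommRing R] {d m : Ideal R} (hdm : d ≤ m) {u : (R ⧸ d)ˣ}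
    {x : R} (hx : Ideal.Quotient.mk d x = u) :
    u ∈ unitsCongrOne (m.map (Ideal.Quotient.mk d)) ↔ x - 1 ∈ m := by
  change (u : R ⧸ d) - 1 ∈ m.map (Ideal.Quotient.mk d) ↔ _
  rw [← hx, ← map_one (Ideal.Quotient.mk d), ← map_sub, ← Ideal.mem_comap,
    Ideal.comap_map_of_surjective' _ Ideal.Quotient.mk_surjective, Ideal.mk_ker,
    sup_eq_left.mpr hdm]

theorem relIndex_coprimeRayElements (hm : m ≠ ⊥) (S : Finset (K →+* ℝ)) :
    (coprimeRayElements O m S).relIndex (coprimeElements O m) *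
      Nat.card (unitsCongrOne (m.map (Ideal.Quotient.mk (colonIdealOrder O m)))) =
    2 ^ S.card * Nat.card (𝓞 K ⧸ colonIdealMax O m)ˣ := by
  have hfin := finite_quotient_colonIdealMax O hm
  have hD := mem_colonIdealMax_iff O m
  have hD0 : colonIdealMax O m ≠ ⊥ := by
    obtain ⟨x, hx, hx0⟩ := Submodule.exists_mem_ne_zero_of_ne_bot (colonIdealOrder_ne_bot O hm)
    refine (Submodule.ne_bot_iff _).mpr ⟨inclusion O x, hx, ?_⟩
    exact (map_ne_zero_iff _ (inclusion_injective O)).mpr hx0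
  obtain ⟨θ, hθ⟩ := exists_residue hm
  set V := unitsCongrOne (m.map (Ideal.Quotient.mk (colonIdealOrder O m)))
  let κ : (O ⧸ colonIdealOrder O m)ˣ →* (𝓞 K ⧸ colonIdealMax O m)ˣ :=
    Units.map (colonQuotientMap O m : _ →* _)
  have hκ : Function.Injective κ := Units.map_injective (colonQuotientMap_injective O)
  let Θ : coprimeElements O m →* (𝓞 K ⧸ colonIdealMax O m)ˣ × (S → SignTypeˣ) :=
    θ.prod ((signsAt S).comp (coprimeElements O m).subtype)
  have hΘ : Function.Surjective Θ := by
    rintro ⟨w, ε⟩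
    obtain ⟨x, hx⟩ := Ideal.Quotient.mk_surjective (w : 𝓞 K ⧸ colonIdealMax O m)
    obtain ⟨z, hz0, hzx, hzε⟩ := exists_sub_mem_and_signsAt_eq hD0 S x ε
    rw [← Ideal.Quotient.eq, hx] at hzx
    have hz1 : (Units.mk0 (z : K) hz0 : K) = (z : K) / ((1 : 𝓞 K) : K) := by simp
    have hzT : Units.mk0 (z : K) hz0 ∈ coprimeElements O m :=
      (mem_coprimeElements_iff hm).mpr
        ⟨z, 1, one_ne_zero, by simp, isUnit_mk_iff.mp (hzx ▸ w.isUnit), hz1⟩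
    refine ⟨⟨_, hzT⟩, Prod.ext (Units.ext ?_) hzε⟩
    exact (hθ ⟨_, hzT⟩ z 1 one_ne_zero (by simp) hz1).trans hzx
  have hker : (coprimeRayElements O m S).subgroupOf (coprimeElements O m) =
      ((V.map κ).prod ⊥).comap Θ := by
    ext α
    rw [Subgroup.mem_subgroupOf, mem_coprimeRayElements_iff, Subgroup.mem_comap,
      Subgroup.mem_prod, Subgroup.mem_bot]
    refine and_congr ?_ signsAt_eq_one_iff.symm
    constructor
    · rintro ⟨x, y, hy0, hyd, hxm, hx, h⟩
      obtain ⟨v, hv⟩ := isUnit_mk_iff.mpr hx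
      refine ⟨v, (unitsCongrOne_mk_iff (colonIdealOrder_le O m) hv.symm).mpr hxm, Units.ext ?_⟩
      refine Eq.trans ?_ (hθ α (inclusion O x) (inclusion O y) ?_ ?_ h).symm
      · rw [← colonQuotientMap_mk, ← hv]
        rfl
      · exact (map_ne_zero_iff _ (inclusion_injective O)).mpr hy0
      · rw [← map_one (inclusion O), ← map_sub]
        exact hyd
    · rintro ⟨v, hv, hvα⟩
      obtain ⟨x, y, hy0, hyd, hx, h⟩ := (mem_coprimeElements_iff hm).mp α.2
      have hθα := hθ α x y hy0 hyd h
      obtain ⟨p, hp⟩ := Ideal.Quotient.mk_surjective (v : O ⧸ colonIdealOrder O m)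
      have hpm := (unitsCongrOne_mk_iff (colonIdealOrder_le O m) hp).mp hv
      have hxp : x - inclusion O p ∈ colonIdealMax O m := by
        rw [← Ideal.Quotient.eq, ← hθα, ← colonQuotientMap_mk, hp]
        exact (congrArg Units.val hvα).symm
      -- Both x - p and y - 1 lie in D, which is contained in O; hence x and y are already in O.
      obtain ⟨e, he, hex⟩ := (hD _).mp hxp
      obtain ⟨e', he', hey⟩ := (hD _).mp hyd
      have hx' : inclusion O (p + e) = x := by rw [map_add, hex]; ring
      have hy' : inclusion O (1 + e') = y := by rw [map_add, hey, map_one]; ring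
      refine ⟨p + e, 1 + e', ?_, by simpa using he', ?_, ?_, ?_⟩
      · rintro h0
        exact hy0 (by rw [← hy', h0, map_zero])
      · rw [add_sub_right_comm]
        exact m.add_mem hpm (colonIdealOrder_le O m he)
      · rw [← isUnit_mk_iff, map_add, Ideal.Quotient.eq_zero_iff_mem.mpr he, add_zero, hp]
        exact v.isUnit
      · rw [h, ← hx', ← hy']
        rfl
  rw [Subgroup.relIndex, hker, Subgroup.index_comap_of_surjective _ hΘ, Subgroup.index_prod,
    Subgroup.index_bot, natCard_signs, ← Subgroup.index_mul_card (V.map κ),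
    Subgroup.card_map_of_injective hκ]
  ring

end Residue

/-! ### Rank of a subgroup of finite index. -/

section Rank

universe u

/-- An injective homomorphism of commutative groups with image of finite index preserves the
rank. -/
theorem rank_additive_eq_of_finiteIndex {G H : Type u} [CommGroup G] [CommGroup H] (f : H →* G)
    (hf : Function.Injective f) (hfin : f.range.index ≠ 0) :
    Module.rank ℤ (Additive H) = Module.rank ℤ (Additive G) := by
  let F : Additive H →ₗ[ℤ] Additive G := (MonoidHom.toAdditive f).toIntLinearMap
  -- The quotient is torsion: it is killed by the index of the image.
  have h0 : Module.rank ℤ (Additive G ⧸ LinearMap.range F) = 0 := by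
    refine rank_eq_zero_iff.mpr fun x => ?_
    obtain ⟨x, rfl⟩ := Submodule.Quotient.mk_surjective _ x
    refine ⟨f.range.index, by exact_mod_cast hfin, ?_⟩
    rw [← Submodule.Quotient.mk_smul, Submodule.Quotient.mk_eq_zero, natCast_zsmul]
    obtain ⟨y, hy⟩ := Subgroup.pow_index_mem f.range x.toMul
    exact ⟨Additive.ofMul y, congrArg Additive.ofMul hy⟩
  rw [← rank_quotient_add_rank_of_isDomain (LinearMap.range F), h0, zero_add]
  exact (LinearEquiv.ofInjective F hf).rank_eq

end Rank

theorem theorem5p5 {K : Type*} [Field K] [NumberField K]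
    (O : Subring K) [IsNumberFieldOrder O]
    (m : Ideal O) (hm : m ≠ ⊥)
    (S : Finset (K →+* ℝ)) :
    Finite ((𝓞 K)ˣ ⧸ (rayUnitGroup O m S).map
      (Units.map (IsNumberFieldOrder.inclusion O : O →* 𝓞 K))) ∧
    Finite (RayClassGroup O m S) ∧
    (Nat.card (RayClassGroup O m S) : ℚ) =
      (NumberField.classNumber K : ℚ) /
          (((rayUnitGroup O m S).map
            (Units.map (IsNumberFieldOrder.inclusion O : O →* 𝓞 K))).index : ℚ) *
        ((2 ^ S.card * Nat.card (𝓞 K ⧸ colonIdealMax O m)ˣ : ℚ) /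
          (Nat.card (unitsCongrOne
            (m.map (Ideal.Quotient.mk (colonIdealOrder O m)))) : ℚ)) ∧
    Module.rank ℤ (Additive (rayUnitGroup O m S)) = Module.rank ℤ (Additive (𝓞 K)ˣ) ∧
    Module.rank ℤ (Additive (𝓞 K)ˣ) =
      ((NumberField.InfinitePlace.nrRealPlaces K +
        NumberField.InfinitePlace.nrComplexPlaces K - 1 : ℕ) : Cardinal) := by
  have hfin := finite_quotient_colonIdealMax O hm
  have hfin' := finite_quotient_colonIdealOrder O hm
  have h1 := relIndex_principalRayIdeals hm S
  have h2 := relIndex_coprimeRayElements hm S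
  have hcard : Nat.card (RayClassGroup O m S) =
      (principalRayIdeals O m S).relIndex (coprimeFractionalIdeals O m) := rfl
  rw [← hcard] at h1
  set U := (rayUnitGroup O m S).map (Units.map (IsNumberFieldOrder.inclusion O : O →* 𝓞 K)) with hU
  set V := unitsCongrOne (m.map (Ideal.Quotient.mk (colonIdealOrder O m)))
  have hV : Nat.card V ≠ 0 := Nat.card_pos.ne'
  have hB : Nat.card (𝓞 K ⧸ colonIdealMax O m)ˣ ≠ 0 := Nat.card_pos.ne'
  have hh : NumberField.classNumber K ≠ 0 := Fintype.card_ne_zero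
  have hprod : Nat.card (RayClassGroup O m S) * U.index * Nat.card V =
      NumberField.classNumber K * (2 ^ S.card * Nat.card (𝓞 K ⧸ colonIdealMax O m)ˣ) := by
    rw [h1, mul_assoc, h2]
  -- `Nat.card` and `index` vanish on infinite objects, so a nonzero product forces finiteness of
  -- each factor.
  have hne : Nat.card (RayClassGroup O m S) * U.index * Nat.card V ≠ 0 := by
    rw [hprod]
    exact mul_ne_zero hh (mul_ne_zero (by positivity) hB)
  have hCl : Nat.card (RayClassGroup O m S) ≠ 0 := left_ne_zero_of_mul (left_ne_zero_of_mul hne)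
  have hUi : U.index ≠ 0 := right_ne_zero_of_mul (left_ne_zero_of_mul hne)
  have hUfin : U.FiniteIndex := ⟨hUi⟩
  refine ⟨inferInstance, Nat.finite_of_card_ne_zero hCl, ?_, ?_, ?_⟩
  · have hV' : (Nat.card V : ℚ) ≠ 0 := by exact_mod_cast hV
    have hU' : (U.index : ℚ) ≠ 0 := by exact_mod_cast hUi
    have hprod' : (Nat.card (RayClassGroup O m S) * U.index * Nat.card V : ℚ) =
      NumberField.classNumber K * (2 ^ S.card * Nat.card (𝓞 K ⧸ colonIdealMax O m)ˣ) := by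
      exact_mod_cast hprod
    field_simp
    linear_combination hprod'
  · refine rank_additive_eq_of_finiteIndex
      ((Units.map (IsNumberFieldOrder.inclusion O : O →* 𝓞 K)).comp
        (rayUnitGroup O m S).subtype)
      ((Units.map_injective (inclusion_injective O)).comp Subtype.val_injective) ?_
    rwa [MonoidHom.range_comp, Subgroup.range_subtype]
  · rw [← Module.finrank_eq_rank, NumberField.Units.finrank_eq, NumberField.Units.rank,
      NumberField.InfinitePlace.card_eq_nrRealPlaces_add_nrComplexPlaces]
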